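/- Let $\Bbbk$ be a field of characteristic $0$, let $A$ be an associative unital $\Bbbk$-algebra with a finite complete family of orthogonal idempotents $(e_s)_{s\in I}$ (so $e_se_t=\delta_{st}e_s$, $\sum_s e_s=1$), and let $B=\sum_{s\in I}\Bbbk e_s\subset A$. Write $\otimes=\otimes_\Bbbk$. A *double bracket* on $A$ over $B$ is a $\Bbbk$-bilinear map $\{\!\{-,-\}\!\}:A\times A\to A\otimes A$, written $\{\!\{a,b\}\!\}=\{\!\{a,b\}\!\}'\otimes\{\!\{a,b\}\!\}''$ (sum understood), which vanishes when one argument lies in $B$ and satisfies, for all $a,b,c\in A$, $\{\!\{a,b\}\!\}=-\{\!\{b,a\}\!\}''\otimes\{\!\{b,a\}\!\}'$ and $\{\!\{a,bc\}\!\}=\{\!\{a,b\}\!\}c+b\{\!\{a,c\}\!\}$, where $b(d'\otimes d'')c=bd'\otimes d''c$. With $\tau(a_1\otimes a_2\otimes a_3)=a_3\otimes a_1\otimes a_2$, its triple bracket is $$\{\!\{a,b,c\}\!\}=\{\!\{a,\{\!\{b,c\}\!\}'\}\!\}\otimes\{\!\{b,c\}\!\}''+\tau\big(\{\!\{b,\{\!\{c,a\}\!\}'\}\!\}\otimes\{\!\{c,a\}\!\}''\big)+\tau^2\big(\{\!\{c,\{\!\{a,b\}\!\}'\}\!\}\otimes\{\!\{a,b\}\!\}''\big).$$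 $(A,\{\!\{-,-\}\!\})$ is a *double quasi-Poisson algebra over $B$* if for all $a,b,c\in A$ $$\begin{aligned}\{\!\{a,b,c\}\!\}=\tfrac14\sum_{s\in I}\big(& ce_sa\otimes e_sb\otimes e_s-ce_sa\otimes e_s\otimes be_s-ce_s\otimes ae_sb\otimes e_s+ce_s\otimes ae_s\otimes be_s\\&-e_sa\otimes e_sb\otimes e_sc+e_sa\otimes e_s\otimes be_sc+e_s\otimes ae_sb\otimes e_sc-e_s\otimes ae_s\otimes be_sc\big).\end{aligned}$$ For $\alpha\in\mathbb N^I$ and $N=\sum_s\alpha_s$, let $R=\mathcal O(\operatorname{Rep}(A,\alpha))$ be the commutative $\Bbbk$-algebra generated by symbols $a_{ij}$ ($a\in A$, $1\le i,j\le N$), $\Bbbk$-linear in $a$, with relations $(ab)_{ij}=\sum_l a_{il}b_{lj}$ and with $\mathcal X(e_s)$ equal to the $s$-th diagonal identity block of size $\alpha_s$; here $\mathcal X(a)=(a_{ij})$. The group $\operatorname{GL}_\alpha=\prod_s\operatorname{GL}_{\alpha_s}(\Bbbk)$ acts on $R$ by algebra automorphisms with $g.\mathcal X(a)=g^{-1}\mathcal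 X(a)g$, and on the Lie algebra $\mathfrak g_\alpha=\prod_s\mathfrak{gl}_{\alpha_s}(\Bbbk)$ by ${}^g\eta=g\eta g^{-1}$; $\mathfrak g_\alpha$ acts on $R$ by derivations $\eta_R$ with $\eta_R(\mathcal X(a))=[\mathcal X(a),\eta]$ (matrices are embedded block-diagonally). Put $(\eta|\xi)=\operatorname{tr}(\eta\xi)$ on $\mathfrak g_\alpha$. **Theorem.** If $(A,\{\!\{-,-\}\!\})$ is a double quasi-Poisson algebra over $B$, then there is a unique antisymmetric biderivation $\{-,-\}$ on $R$ with $$\{a_{ij},b_{kl}\}=\{\!\{a,b\}\!\}'_{kj}\,\{\!\{a,b\}\!\}''_{il}\qquad(a,b\in A,\ 1\le i,j,k,l\le N),$$ and it makes $R$ a quasi-Poisson algebra over the pair $(\operatorname{GL}_\alpha,\mathfrak g_\alpha)$. That is: the form $(-|-)$ is symmetric, non-degenerate and invariant; $\operatorname{GL}_\alpha$ acts on $\mathfrak g_\alpha$ by Lie algebra automorphisms and $\eta\mapsto\eta_R$ is a Lie algebra homomorphism; and for all $g\in\operatorname{GL}_\alpha$, $\eta\in\mathfrak g_\alpha$, $a,b,c\in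 R$, $$({}^g\eta)_R\,a=g.\eta_R(g^{-1}.a),\qquad \eta_R\{a,b\}=\{\eta_R a,b\}+\{a,\eta_R b\},\qquad g.\{a,b\}=\{g.a,g.b\},$$ $$\{a,\{b,c\}\}+\{b,\{c,a\}\}+\{c,\{a,b\}\}=\tfrac12\,\phi_R(a,b,c),\qquad {}^g\phi=\phi,$$ where $\phi=\frac1{12}\sum_{i,j,k}(\varepsilon^i|[\varepsilon^j,\varepsilon^k])\,\varepsilon_i\wedge\varepsilon_j\wedge\varepsilon_k\in\bigwedge^3\mathfrak g_\alpha$ is the Cartan trivector, for dual bases $(\varepsilon_i),(\varepsilon^i)$ of $\mathfrak g_\alpha$ under the trace form, and $(\eta^1\wedge\eta^2\wedge\eta^3)_R(a_1,a_2,a_3)=\sum_{\sigma\in S_3}\operatorname{sgn}(\sigma)\prod_{i}\eta^{\sigma(i)}_R(a_i)$. -/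

import Mathlib

open scoped TensorProduct

noncomputable section

/-! ### Double brackets and double quasi-Poisson algebras -/

section DoubleBrackets

variable {k : Type*} [Field k] {A : Type*} [Ring A] [Algebra k A]

/-- `dbr` is a double bracket on `A`, linear over the span `B` of the idempotents `e s`.
The outer bimodule structure `b · (d' ⊗ d'') · c = b d' ⊗ d'' c` is written through the product
of the algebra `A ⊗ A`. -/
structure IsDoubleBracket {I : Type*} (e : I → A) (dbr : A →ₗ[k] A →ₗ[k] A ⊗[k] A) : Prop where
  /-- cyclic antisymmetry -/
  antisymm : ∀ a b, dbr a b = -(TensorProduct.comm k A A (dbr b a))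
  /-- right derivation rule, for the outer bimodule structure -/
  leibniz : ∀ a b c, dbr a (b * c) = dbr a b * (1 ⊗ₜ[k] c) + (b ⊗ₜ[k] 1) * dbr a c
  /-- vanishing on `B`, first argument -/
  left_base : ∀ b ∈ Submodule.span k (Set.range e), ∀ a, dbr b a = 0
  /-- vanishing on `B`, second argument -/
  right_base : ∀ b ∈ Submodule.span k (Set.range e), ∀ a, dbr a b = 0

variable (k A) in
/-- The cyclic permutation `a₁ ⊗ a₂ ⊗ a₃ ↦ a₃ ⊗ a₁ ⊗ a₂`. -/
def tensorRot : (A ⊗[k] A) ⊗[k] A →ₗ[k] (A ⊗[k] A) ⊗[k] A :=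
  (TensorProduct.assoc k A A A).symm.toLinearMap ∘ₗ
    (TensorProduct.comm k (A ⊗[k] A) A).toLinearMap

/-- The triple bracket associated with a double bracket. Here `(dbr a).rTensor A` sends
`x ⊗ y` to `{{a, x}} ⊗ y`. -/
def tripleBracket (dbr : A →ₗ[k] A →ₗ[k] A ⊗[k] A) (a b c : A) : (A ⊗[k] A) ⊗[k] A :=
  (dbr a).rTensor A (dbr b c)
    + tensorRot k A ((dbr b).rTensor A (dbr c a))
    + tensorRot k A (tensorRot k A ((dbr c).rTensor A (dbr a b)))

/-- `(A, dbr)` is a double quasi-Poisson algebra over `B = ⊕ k e_s`. -/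
structure IsDoubleQuasiPoisson {I : Type*} [Fintype I] (e : I → A)
    (dbr : A →ₗ[k] A →ₗ[k] A ⊗[k] A) : Prop extends IsDoubleBracket e dbr where
  quasiPoisson : ∀ a b c : A,
    tripleBracket dbr a b c = (1 / 4 : k) • ∑ s,
      ( (c * e s * a) ⊗ₜ[k] (e s * b) ⊗ₜ[k] (e s)
      - (c * e s * a) ⊗ₜ[k] (e s) ⊗ₜ[k] (b * e s)
      - (c * e s) ⊗ₜ[k] (a * e s * b) ⊗ₜ[k] (e s)
      + (c * e s) ⊗ₜ[k] (a * e s) ⊗ₜ[k] (b * e s)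
      - (e s * a) ⊗ₜ[k] (e s * b) ⊗ₜ[k] (e s * c)
      + (e s * a) ⊗ₜ[k] (e s) ⊗ₜ[k] (b * e s * c)
      + (e s) ⊗ₜ[k] (a * e s * b) ⊗ₜ[k] (e s * c)
      - (e s) ⊗ₜ[k] (a * e s) ⊗ₜ[k] (b * e s * c) )

end DoubleBrackets

/-! ### Quasi-Poisson algebras over a pair `(G, 𝔤)` -/

section QuasiPoisson

variable {k : Type*} [Field k]

/-- Antisymmetric biderivations of a commutative algebra. -/
structure IsAntisymmBiderivation {R : Type*} [CommRing R] [Algebra k R]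
    (br : R →ₗ[k] R →ₗ[k] R) : Prop where
  antisymm : ∀ a b, br a b = -br b a
  leibniz : ∀ a b c, br a (b * c) = br a b * c + b * br a c

variable {L : Type*} [LieRing L] [LieAlgebra k L]

/-- The Cartan trivector `(1/12) ∑ (εⁱ | [εʲ, εˡ]) ε_i ∧ ε_j ∧ ε_l` in `⋀³ L`, where `(ε_i)` is a
basis of `L` and `(εⁱ)` is the dual basis for the non-degenerate form `κ`. -/
def cartanTrivector [FiniteDimensional k L] (κ : LinearMap.BilinForm k L)
    (hκ : κ.Nondegenerate) : ⋀[k]^3 L :=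
  let ε := Module.finBasis k L
  let ε' := κ.dualBasis hκ ε
  (1 / 12 : k) • ∑ i, ∑ j, ∑ l,
    κ (ε' i) ⁅ε' j, ε' l⁆ • exteriorPower.ιMulti k 3 ![ε i, ε j, ε l]

variable {R : Type*} [CommRing R] [Algebra k R]

/-- For `ψ ∈ ⋀³ L`, the value `ψ_R(a, b, c)`: it is linear in `ψ`, and
`(x₀ ∧ x₁ ∧ x₂)_R(a₀, a₁, a₂) = ∑_σ sign(σ) ∏_i (x_{σ i})_R(a_i)`, the sum being over all
permutations `σ` (no factor `1/6`). -/
def trivectorEval (act : L →ₗ⁅k⁆ Derivation k R R) (a b c : R) : ⋀[k]^3 L →ₗ[k] R :=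
  exteriorPower.alternatingMapLinearEquiv
    (MultilinearMap.alternatization
      ((MultilinearMap.mkPiAlgebra k (Fin 3) R).compLinearMap
        (fun i : Fin 3 =>
          ({ toFun := fun η => act η ((![a, b, c] : Fin 3 → R) i)
             map_add' := fun x y => by simp
             map_smul' := fun t x => by simp } : L →ₗ[k] R))))

/-- `R` with the bracket `br` is a quasi-Poisson algebra over the pair `(G, L)`, where
* `κ` is the invariant non-degenerate symmetric form on the Lie algebra `L`;
* `Ad` is the left action of `G` on `L`, by Lie algebra automorphisms;
* `ρ` is the left action of `G` on `R`, by algebra automorphisms;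
* `act` is the action of `L` on `R`, by derivations. -/
structure IsQuasiPoissonAlgebra {G : Type*} [Group G] [FiniteDimensional k L]
    (κ : LinearMap.BilinForm k L) (Ad : G →* Module.End k L)
    (ρ : G →* (R →ₐ[k] R)) (act : L →ₗ⁅k⁆ Derivation k R R)
    (br : R →ₗ[k] R →ₗ[k] R) : Prop where
  form_symm : ∀ x y, κ x y = κ y x
  form_nondegenerate : κ.Nondegenerate
  form_invariant : ∀ x y z, κ x ⁅y, z⁆ = κ ⁅x, y⁆ z
  Ad_lie : ∀ g x y, Ad g ⁅x, y⁆ = ⁅Ad g x, Ad g y⁆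
  /-- compatibility of the actions of `G` and of `L` on `R` -/
  compatible : ∀ g η a, act (Ad g η) a = ρ g (act η (ρ g⁻¹ a))
  biderivation : IsAntisymmBiderivation br
  lie_invariant : ∀ η a b, act η (br a b) = br (act η a) b + br a (act η b)
  /-- the Jacobi identity up to the Cartan trivector -/
  quasiJacobi : ∀ a b c, br a (br b c) + br b (br c a) + br c (br a b)
    = (1 / 2 : k) • trivectorEval act a b c (cartanTrivector κ form_nondegenerate)
  group_invariant : ∀ g a b, ρ g (br a b) = br (ρ g a) (ρ g b)
  cartan_invariant : ∀ g, exteriorPower.map 3 (Ad g) (cartanTrivector κ form_nondegenerate)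
    = cartanTrivector κ form_nondegenerate

end QuasiPoisson

/-! ### Representation spaces -/

section RepSpaces

variable {k : Type*} [Field k] {A : Type*} [Ring A] [Algebra k A]
variable {I : Type*} [Fintype I] [DecidableEq I]

/-- The set of matrix indices `{1, …, N}`, `N = ∑ α_s`, cut into its consecutive blocks of
sizes `α_s`: the index `⟨s, i⟩` is the `i`-th one in the `s`-th block. -/
abbrev RepIndex (α : I → ℕ) : Type _ := Σ s : I, Fin (α s)

/-- The `s`-th diagonal identity block. -/
def blockId (S : Type*) [CommRing S] (α : I → ℕ) (s : I) :
    Matrix (RepIndex α) (RepIndex α) S :=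
  Matrix.of fun i j => if i = j ∧ i.1 = s then 1 else 0

variable (k) in
/-- The generic matrix `(a_ij)` of symbols. -/
def symbolMatrix (α : I → ℕ) (a : A) :
    Matrix (RepIndex α) (RepIndex α) (MvPolynomial (A × RepIndex α × RepIndex α) k) :=
  Matrix.of fun i j => MvPolynomial.X (a, i, j)

variable (k) in
/-- The defining relations of the coordinate ring of `Rep(A, α)`. -/
inductive RepRel (e : I → A) (α : I → ℕ) : MvPolynomial (A × RepIndex α × RepIndex α) k → Prop
  | add (a b : A) (i j : RepIndex α) : RepRel e α
      (symbolMatrix k α (a + b) i j - (symbolMatrix k α a i j + symbolMatrix k α b i j))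
  | smul (t : k) (a : A) (i j : RepIndex α) : RepRel e α
      (symbolMatrix k α (t • a) i j - t • symbolMatrix k α a i j)
  | mul (a b : A) (i j : RepIndex α) : RepRel e α
      (symbolMatrix k α (a * b) i j - (symbolMatrix k α a * symbolMatrix k α b) i j)
  | idem (s : I) (i j : RepIndex α) : RepRel e α
      (symbolMatrix k α (e s) i j - blockId _ α s i j)

variable (k) in
/-- The ideal generated by the defining relations. -/
def repIdeal (e : I → A) (α : I → ℕ) :
    Ideal (MvPolynomial (A × RepIndex α × RepIndex α) k) :=
  Ideal.span {p | RepRel k e α p}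

variable (k) in
/-- The coordinate ring `O(Rep(A, α))`. -/
abbrev RepRing (e : I → A) (α : I → ℕ) : Type _ :=
  MvPolynomial (A × RepIndex α × RepIndex α) k ⧸ repIdeal k e α

variable (k) in
/-- The matrix `X(a) = (a_ij)` over `O(Rep(A, α))`. -/
def repX (e : I → A) (α : I → ℕ) (a : A) :
    Matrix (RepIndex α) (RepIndex α) (RepRing k e α) :=
  (symbolMatrix k α a).map (Ideal.Quotient.mkₐ k (repIdeal k e α))

variable (e : I → A) (α : I → ℕ)

theorem repRel_mk {p : MvPolynomial (A × RepIndex α × RepIndex α) k} (h : RepRel k e α p) :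
    Ideal.Quotient.mkₐ k (repIdeal k e α) p = 0 :=
  Ideal.Quotient.eq_zero_iff_mem.mpr (Ideal.subset_span h)

theorem repX_add (a b : A) : repX k e α (a + b) = repX k e α a + repX k e α b := by
  ext i j
  have h := repRel_mk e α (RepRel.add (k := k) a b i j)
  rw [map_sub, sub_eq_zero, map_add] at h
  exact h

theorem repX_smul (t : k) (a : A) : repX k e α (t • a) = t • repX k e α a := by
  ext i j
  have h := repRel_mk e α (RepRel.smul (k := k) t a i j)
  rw [map_sub, sub_eq_zero, map_smul] at h
  exact h

theorem repX_mul (a b : A) : repX k e α (a * b) = repX k e α a * repX k e α b := by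
  ext i j
  have h := repRel_mk e α (RepRel.mul (k := k) a b i j)
  rw [map_sub, sub_eq_zero, Matrix.mul_apply, map_sum] at h
  simp only [map_mul] at h
  exact h

theorem repX_idem (s : I) : repX k e α (e s) = blockId (RepRing k e α) α s := by
  ext i j
  have h := repRel_mk e α (RepRel.idem (k := k) (e := e) s i j)
  rw [map_sub, sub_eq_zero] at h
  refine h.trans ?_
  simp only [blockId, Matrix.of_apply]
  split_ifs <;> simp

variable (k) in
/-- The `(i, j)` entry `a ↦ a_ij`, as a linear map. -/
def repEntry (i j : RepIndex α) : A →ₗ[k] RepRing k e α where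
  toFun a := repX k e α a i j
  map_add' a b := by rw [repX_add]; rfl
  map_smul' t a := by rw [repX_smul]; rfl

variable (k) in
/-- The linear map `d' ⊗ d'' ↦ d'_ij d''_lm`. -/
def repEntry₂ (i j l m : RepIndex α) : A ⊗[k] A →ₗ[k] RepRing k e α :=
  LinearMap.mul' k (RepRing k e α) ∘ₗ
    TensorProduct.map (repEntry k e α i j) (repEntry k e α l m)

/-- `br` is the antisymmetric biderivation induced by the double bracket `dbr`:
`{a_ij, b_lm} = {{a, b}}'_lj {{a, b}}''_im`. -/
structure IsInducedBracket (dbr : A →ₗ[k] A →ₗ[k] A ⊗[k] A)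
    (br : RepRing k e α →ₗ[k] RepRing k e α →ₗ[k] RepRing k e α) : Prop where
  biderivation : IsAntisymmBiderivation br
  on_generators : ∀ (a b : A) (i j l m : RepIndex α),
    br (repX k e α a i j) (repX k e α b l m) = repEntry₂ k e α l j i m (dbr a b)

/-- Two algebra maps out of `O(Rep(A, α))` agreeing on the generators are equal. -/
theorem repRing_algHom_ext {S : Type*} [CommRing S] [Algebra k S]
    {f g : RepRing k e α →ₐ[k] S}
    (h : ∀ a i j, f (repX k e α a i j) = g (repX k e α a i j)) : f = g := by
  apply Ideal.Quotient.algHom_ext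
  apply MvPolynomial.algHom_ext
  rintro ⟨a, i, j⟩
  exact h a i j

/-- Two derivations of `O(Rep(A, α))` agreeing on the generators are equal. -/
theorem repRing_derivation_ext {D D' : Derivation k (RepRing k e α) (RepRing k e α)}
    (h : ∀ a i j, D (repX k e α a i j) = D' (repX k e α a i j)) : D = D' := by
  ext x
  obtain ⟨p, rfl⟩ := Ideal.Quotient.mkₐ_surjective k (repIdeal k e α) x
  induction p using MvPolynomial.induction_on with
  | C t =>
    have : Ideal.Quotient.mkₐ k (repIdeal k e α) (MvPolynomial.C t)
        = algebraMap k (RepRing k e α) t := rfl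
    rw [this, Derivation.map_algebraMap, Derivation.map_algebraMap]
  | add p q hp hq => rw [map_add, map_add, map_add, hp, hq]
  | mul_X p n hp =>
    obtain ⟨a, i, j⟩ := n
    have := h a i j
    rw [map_mul, Derivation.leibniz, Derivation.leibniz, hp]
    congr 2

/-- Algebra maps out of `O(Rep(A, α))` from representations of `A` over `S`. -/
def repLift {S : Type*} [CommRing S] [Algebra k S]
    (Y : A →ₗ[k] Matrix (RepIndex α) (RepIndex α) S)
    (hmul : ∀ a b, Y (a * b) = Y a * Y b) (hid : ∀ s, Y (e s) = blockId S α s) :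
    RepRing k e α →ₐ[k] S :=
  Ideal.Quotient.liftₐ (repIdeal k e α)
    (MvPolynomial.aeval fun x : A × RepIndex α × RepIndex α => Y x.1 x.2.1 x.2.2) (by
      intro p hp
      have hle : repIdeal k e α ≤ RingHom.ker (MvPolynomial.aeval (R := k)
          fun x : A × RepIndex α × RepIndex α => Y x.1 x.2.1 x.2.2) := by
        refine Ideal.span_le.mpr ?_
        rintro p (⟨a, b, i, j⟩ | ⟨t, a, i, j⟩ | ⟨a, b, i, j⟩ | ⟨s, i, j⟩)
        · simp [symbolMatrix]
        · simp [symbolMatrix]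
        · simp [symbolMatrix, Matrix.mul_apply, hmul]
        · simp only [symbolMatrix, blockId, SetLike.mem_coe, RingHom.mem_ker, map_sub,
            Matrix.of_apply, MvPolynomial.aeval_X, hid]
          split_ifs <;> simp
      exact hle hp)

theorem repLift_repX {S : Type*} [CommRing S] [Algebra k S]
    (Y : A →ₗ[k] Matrix (RepIndex α) (RepIndex α) S)
    (hmul : ∀ a b, Y (a * b) = Y a * Y b) (hid : ∀ s, Y (e s) = blockId S α s)
    (a : A) (i j : RepIndex α) :
    repLift e α Y hmul hid (repX k e α a i j) = Y a i j := by
  change MvPolynomial.aeval (fun x : A × RepIndex α × RepIndex α => Y x.1 x.2.1 x.2.2)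
    (MvPolynomial.X (a, i, j)) = _
  rw [MvPolynomial.aeval_X]

end RepSpaces

/-! ### The group `GL_α`, its Lie algebra, and their actions -/

section Actions

variable (k : Type*) [Field k] {A : Type*} [Ring A] [Algebra k A]
variable {I : Type*} [Fintype I] [DecidableEq I]

/-- `GL_α = ∏ GL_{α_s}(k)`. -/
abbrev GLα (α : I → ℕ) : Type _ := ∀ s, GL (Fin (α s)) k

/-- `𝔤_α = ∏ 𝔤𝔩_{α_s}(k)`, with the commutator bracket. -/
abbrev LieGLα (α : I → ℕ) : Type _ := ∀ s, Matrix (Fin (α s)) (Fin (α s)) k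

instance instLieRingα (α : I → ℕ) : LieRing (LieGLα k α) := LieRing.ofAssociativeRing

instance instLieAlgebraα (α : I → ℕ) : LieAlgebra k (LieGLα k α) :=
  LieAlgebra.ofAssociativeAlgebra

variable (α : I → ℕ)

/-- The trace pairing `(η | ξ) = tr(η ξ)` on `𝔤_α`. -/
def traceFormα : LinearMap.BilinForm k (LieGLα k α) :=
  LinearMap.mk₂ k (fun η ξ => ∑ s, (η s * ξ s).trace)
    (fun x y z => by simp [add_mul, Finset.sum_add_distrib])
    (fun t x y => by simp [Finset.mul_sum])
    (fun x y z => by simp [mul_add, Finset.sum_add_distrib])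
    (fun t x y => by simp [Finset.mul_sum])

/-- The adjoint action `η ↦ g η g⁻¹` of `GL_α` on `𝔤_α`. -/
def adjointα : GLα k α →* Module.End k (LieGLα k α) where
  toFun g :=
    { toFun := fun η s => (g s).1 * η s * (g s)⁻¹.1
      map_add' := fun x y => by ext s : 1; simp [mul_add, add_mul]
      map_smul' := fun t x => by ext s : 1; simp }
  map_one' := by ext η s : 2; simp
  map_mul' g h := by ext η s : 2; simp [mul_assoc]

/-- A tuple of square matrices as a block diagonal matrix with entries in `S`. -/
def blockMat (S : Type*) [CommRing S] [Algebra k S] :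
    LieGLα k α →ₐ[k] Matrix (RepIndex α) (RepIndex α) S where
  toFun η := (Matrix.blockDiagonal' η).map (algebraMap k S)
  map_one' := by
    have : (1 : LieGLα k α) = fun s => 1 := rfl
    rw [this, show Matrix.blockDiagonal' (fun s => (1 : Matrix (Fin (α s)) (Fin (α s)) k)) = 1
      from Matrix.blockDiagonal'_one]
    simp
  map_zero' := by simp
  map_mul' x y := by
    rw [← Matrix.map_mul, ← Matrix.blockDiagonal'_mul]; rfl
  map_add' x y := by
    rw [Matrix.blockDiagonal'_add, Matrix.map_add _ (map_add _)]
  commutes' t := by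
    ext ⟨s, i⟩ ⟨s', j⟩
    by_cases h : s = s'
    · subst h
      simp only [Matrix.map_apply, Matrix.blockDiagonal'_apply, Pi.algebraMap_apply,
        Matrix.algebraMap_matrix_apply, Sigma.mk.injEq, heq_eq_eq, true_and, dite_true, cast_eq]
      split_ifs <;> simp
    · simp [Matrix.algebraMap_matrix_apply, Matrix.blockDiagonal'_apply, h]

theorem blockId_eq_blockMat (S : Type*) [CommRing S] [Algebra k S] (s : I) :
    blockId S α s = blockMat k α S (Pi.single s 1) := by
  ext ⟨t, i⟩ ⟨t', j⟩
  change _ = algebraMap k S (Matrix.blockDiagonal' _ _ _)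
  by_cases h : t = t'
  · subst h
    by_cases hs : t = s
    · subst hs
      by_cases hij : i = j <;> simp [blockId, Matrix.blockDiagonal'_apply, hij]
    · simp [blockId, Matrix.blockDiagonal'_apply, hs]
  · simp [blockId, Matrix.blockDiagonal'_apply, h]

theorem blockMat_comm_blockId (S : Type*) [CommRing S] [Algebra k S] (η : LieGLα k α) (s : I) :
    blockId S α s * blockMat k α S η = blockMat k α S η * blockId S α s := by
  rw [blockId_eq_blockMat k, ← map_mul, ← map_mul]
  congr 1
  ext t : 1
  by_cases h : t = s
  · subst h; simp
  · simp [h]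

variable {k} {α}

/-- The tuple of matrices underlying an element of `GL_α`. -/
def GLα.toLie (g : GLα k α) : LieGLα k α := fun s => (g s).1

theorem GLα.toLie_one : GLα.toLie (1 : GLα k α) = 1 := rfl

theorem GLα.toLie_mul (g h : GLα k α) : (g * h).toLie = g.toLie * h.toLie := rfl

variable (e : I → A)

/-- The matrix `g⁻¹ X(a) g` over `O(Rep(A, α))`. -/
def conjX (g : GLα k α) (a : A) : Matrix (RepIndex α) (RepIndex α) (RepRing k e α) :=
  blockMat k α _ g⁻¹.toLie * repX k e α a * blockMat k α _ g.toLie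

theorem algHom_map_blockMat {S T : Type*} [CommRing S] [Algebra k S] [CommRing T] [Algebra k T]
    (f : S →ₐ[k] T) (η : LieGLα k α) :
    (blockMat k α S η).map f = blockMat k α T η := by
  ext i j
  exact f.commutes _

variable (α)

/-- The left action of `GL_α` on `O(Rep(A, α))`: `g . X(a) = g⁻¹ X(a) g`. -/
def repGroupActionHom (g : GLα k α) : RepRing k e α →ₐ[k] RepRing k e α :=
  repLift e α
    { toFun := fun a => conjX e g a
      map_add' := fun a b => by simp only [conjX]; rw [repX_add, mul_add, add_mul]
      map_smul' := fun t a => by simp [conjX, repX_smul] }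
    (fun a b => by
      have h : blockMat k α (RepRing k e α) g.toLie * blockMat k α _ g⁻¹.toLie = 1 := by
        rw [← map_mul, ← GLα.toLie_mul, mul_inv_cancel, GLα.toLie_one, map_one]
      change conjX e g (a * b) = conjX e g a * conjX e g b
      simp only [conjX]
      rw [repX_mul]
      calc _ = blockMat k α _ g⁻¹.toLie * repX k e α a * 1 * repX k e α b
              * blockMat k α _ g.toLie := by simp only [mul_assoc, one_mul]
        _ = _ := by rw [← h]; simp only [mul_assoc])
    (fun s => by
      change conjX e g (e s) = _
      rw [conjX, repX_idem, ← blockMat_comm_blockId, mul_assoc, ← map_mul, ← GLα.toLie_mul,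
        inv_mul_cancel, GLα.toLie_one, map_one, mul_one])

theorem repGroupActionHom_repX (g : GLα k α) (a : A) (i j : RepIndex α) :
    repGroupActionHom α e g (repX k e α a i j) = conjX e g a i j :=
  repLift_repX e α _ _ _ a i j

/-- The left action of `GL_α` on `O(Rep(A, α))`: `g . X(a) = g⁻¹ X(a) g`. -/
def repGroupAction : GLα k α →* (RepRing k e α →ₐ[k] RepRing k e α) where
  toFun g := repGroupActionHom α e g
  map_one' := by
    apply repRing_algHom_ext
    intro a i j
    rw [repGroupActionHom_repX, conjX, inv_one, GLα.toLie_one, map_one, one_mul, mul_one]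
    rfl
  map_mul' g h := by
    apply repRing_algHom_ext
    intro a i j
    have key : (conjX e h a).map (repGroupActionHom α e g) = conjX e (g * h) a := by
      have hX : (repX k e α a).map (repGroupActionHom α e g) = conjX e g a := by
        ext i j
        exact repGroupActionHom_repX α e g a i j
      rw [conjX, Matrix.map_mul, Matrix.map_mul, hX, algHom_map_blockMat, algHom_map_blockMat]
      simp only [conjX]
      rw [mul_inv_rev, GLα.toLie_mul, GLα.toLie_mul, map_mul, map_mul]
      simp only [mul_assoc]
    rw [repGroupActionHom_repX, AlgHom.mul_apply, repGroupActionHom_repX, ← key]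
    rfl

theorem repGroupAction_repX (g : GLα k α) (a : A) (i j : RepIndex α) :
    repGroupAction α e g (repX k e α a i j)
      = (blockMat k α (RepRing k e α) g⁻¹.toLie * repX k e α a * blockMat k α (RepRing k e α) g.toLie) i j :=
  repGroupActionHom_repX α e g a i j

/-- The derivation of the polynomial ring on the symbols `a_ij` given by
`X(a) ↦ X(a) η - η X(a)`. -/
def symbolDerivation (η : LieGLα k α) :
    Derivation k (MvPolynomial (A × RepIndex α × RepIndex α) k)
      (MvPolynomial (A × RepIndex α × RepIndex α) k) :=
  MvPolynomial.mkDerivation k fun x =>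
    (symbolMatrix k α x.1 * blockMat k α (MvPolynomial (A × RepIndex α × RepIndex α) k) η - blockMat k α (MvPolynomial (A × RepIndex α × RepIndex α) k) η * symbolMatrix k α x.1) x.2.1 x.2.2

theorem symbolDerivation_symbolMatrix (η : LieGLα k α) (a : A) (i j : RepIndex α) :
    symbolDerivation α η (symbolMatrix k α a i j)
      = (symbolMatrix k α a * blockMat k α (MvPolynomial (A × RepIndex α × RepIndex α) k) η - blockMat k α (MvPolynomial (A × RepIndex α × RepIndex α) k) η * symbolMatrix k α a) i j := by
  change MvPolynomial.mkDerivation k _ (MvPolynomial.X (a, i, j)) = _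
  rw [MvPolynomial.mkDerivation_X]

theorem mk_symbolDerivation_symbolMatrix (η : LieGLα k α) (a : A) (i j : RepIndex α) :
    Ideal.Quotient.mkₐ k (repIdeal k e α) (symbolDerivation α η (symbolMatrix k α a i j))
      = (repX k e α a * blockMat k α (RepRing k e α) η - blockMat k α (RepRing k e α) η * repX k e α a) i j := by
  rw [symbolDerivation_symbolMatrix]
  have : ((symbolMatrix k α a * blockMat k α (MvPolynomial (A × RepIndex α × RepIndex α) k) η
      - blockMat k α (MvPolynomial (A × RepIndex α × RepIndex α) k) η * symbolMatrix k α a).map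
      (Ideal.Quotient.mkₐ k (repIdeal k e α)))
      = repX k e α a * blockMat k α (RepRing k e α) η - blockMat k α (RepRing k e α) η * repX k e α a := by
    rw [Matrix.map_sub _ (map_sub _), Matrix.map_mul, Matrix.map_mul, algHom_map_blockMat]
    rfl
  exact congrFun (congrFun this i) j

theorem mk_symbolDerivation_rel (η : LieGLα k α)
    {p : MvPolynomial (A × RepIndex α × RepIndex α) k} (h : RepRel k e α p) :
    Ideal.Quotient.mkₐ k (repIdeal k e α) (symbolDerivation α η p) = 0 := by
  rcases h with ⟨a, b, i, j⟩ | ⟨t, a, i, j⟩ | ⟨a, b, i, j⟩ | ⟨s, i, j⟩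
  · simp only [map_sub, map_add, mk_symbolDerivation_symbolMatrix, repX_add]
    rw [← Matrix.add_apply, ← Matrix.sub_apply, add_mul, mul_add]
    simp only [Matrix.sub_apply, Matrix.add_apply]
    ring
  · rw [map_sub, map_sub, Derivation.map_smul, map_smul, mk_symbolDerivation_symbolMatrix,
      mk_symbolDerivation_symbolMatrix, repX_smul]
    simp only [Matrix.sub_apply, Matrix.smul_mul, Matrix.mul_smul, Matrix.smul_apply, smul_sub,
      sub_self]
  · set π := Ideal.Quotient.mkₐ k (repIdeal k e α)
    have hX : ∀ (c : A) (l m : RepIndex α), π (symbolMatrix k α c l m) = repX k e α c l m :=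
      fun _ _ _ => rfl
    rw [map_sub, map_sub, mk_symbolDerivation_symbolMatrix, Matrix.mul_apply, map_sum, map_sum]
    simp only [Derivation.leibniz, smul_eq_mul, map_add, map_mul, hX, π,
      mk_symbolDerivation_symbolMatrix]
    have hs : ∑ x, (repX k e α a i x *
          (repX k e α b * blockMat k α (RepRing k e α) η - blockMat k α (RepRing k e α) η * repX k e α b) x j +
        repX k e α b x j *
          (repX k e α a * blockMat k α (RepRing k e α) η - blockMat k α (RepRing k e α) η * repX k e α a) i x)
        = (repX k e α a * (repX k e α b * blockMat k α (RepRing k e α) η - blockMat k α (RepRing k e α) η * repX k e α b)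
          + (repX k e α a * blockMat k α (RepRing k e α) η - blockMat k α (RepRing k e α) η * repX k e α a)
            * repX k e α b) i j := by
      rw [Finset.sum_add_distrib, Matrix.add_apply, Matrix.mul_apply, Matrix.mul_apply]
      congr 1
      exact Finset.sum_congr rfl fun _ _ => mul_comm _ _
    refine sub_eq_zero.mpr (Eq.trans ?_ hs.symm)
    rw [repX_mul]
    refine congrFun (congrFun ?_ i) j
    simp only [sub_mul, mul_sub, mul_add, add_mul, mul_assoc]
    abel
  · have h0 : symbolDerivation α η
        (blockId (MvPolynomial (A × RepIndex α × RepIndex α) k) α s i j) = 0 := by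
      simp only [blockId, Matrix.of_apply]
      split_ifs <;> simp
    rw [map_sub, h0, sub_zero, mk_symbolDerivation_symbolMatrix, repX_idem,
      blockMat_comm_blockId, sub_self, Matrix.zero_apply]

theorem mk_symbolDerivation_eq_zero (η : LieGLα k α)
    (p : MvPolynomial (A × RepIndex α × RepIndex α) k)
    (hp : Ideal.Quotient.mkₐ k (repIdeal k e α) p = 0) :
    Ideal.Quotient.mkₐ k (repIdeal k e α) (symbolDerivation α η p) = 0 := by
  have hp' : p ∈ repIdeal k e α := Ideal.Quotient.eq_zero_iff_mem.mp hp
  clear hp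
  induction hp' using Submodule.span_induction with
  | mem p h => exact mk_symbolDerivation_rel α e η h
  | zero => simp
  | add p q _ _ hp hq => rw [map_add, map_add, hp, hq, add_zero]
  | smul r p hp h =>
    have hp0 : Ideal.Quotient.mkₐ k (repIdeal k e α) p = 0 :=
      Ideal.Quotient.eq_zero_iff_mem.mpr hp
    rw [smul_eq_mul, Derivation.leibniz, map_add, smul_eq_mul, smul_eq_mul, map_mul, map_mul, h,
      hp0, mul_zero, zero_mul, add_zero]

/-- The derivation `η_R` of `O(Rep(A, α))`: `η_R(X(a)) = [X(a), η]`. -/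
def repDerivation (η : LieGLα k α) : Derivation k (RepRing k e α) (RepRing k e α) :=
  Derivation.liftOfSurjective (Ideal.Quotient.mkₐ_surjective k (repIdeal k e α))
    (mk_symbolDerivation_eq_zero α e η)

theorem repDerivation_repX (η : LieGLα k α) (a : A) (i j : RepIndex α) :
    repDerivation α e η (repX k e α a i j)
      = (repX k e α a * blockMat k α (RepRing k e α) η - blockMat k α (RepRing k e α) η * repX k e α a) i j := by
  rw [← mk_symbolDerivation_symbolMatrix]
  exact Derivation.liftOfSurjective_apply _ (mk_symbolDerivation_eq_zero α e η) _

theorem derivation_map_blockMat (D : Derivation k (RepRing k e α) (RepRing k e α))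
    (M : Matrix (RepIndex α) (RepIndex α) (RepRing k e α)) (η : LieGLα k α) :
    (M * blockMat k α (RepRing k e α) η - blockMat k α (RepRing k e α) η * M).map D
      = M.map D * blockMat k α (RepRing k e α) η - blockMat k α (RepRing k e α) η * M.map D := by
  have h0 : ∀ i j, D (blockMat k α (RepRing k e α) η i j) = 0 := fun i j =>
    D.map_algebraMap _
  ext i j
  simp only [Matrix.map_apply, Matrix.sub_apply, Matrix.mul_apply, map_sub, map_sum,
    Derivation.leibniz, smul_eq_mul, h0, mul_zero, zero_add, add_zero]
  congr 1
  exact Finset.sum_congr rfl fun _ _ => mul_comm _ _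

/-- The action of `𝔤_α` on `O(Rep(A, α))` by derivations: `η_R(X(a)) = [X(a), η]`. -/
def repLieAction : LieGLα k α →ₗ⁅k⁆ Derivation k (RepRing k e α) (RepRing k e α) where
  toFun η := repDerivation α e η
  map_add' x y := by
    apply repRing_derivation_ext
    intro a i j
    rw [Derivation.add_apply, repDerivation_repX, repDerivation_repX, repDerivation_repX,
      ← Matrix.add_apply, map_add]
    refine congrFun (congrFun ?_ i) j
    simp only [sub_mul, mul_sub, mul_add, add_mul, mul_assoc]
    abel
  map_smul' t x := by
    apply repRing_derivation_ext
    intro a i j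
    rw [RingHom.id_apply, Derivation.smul_apply, repDerivation_repX, repDerivation_repX,
      ← Matrix.smul_apply, map_smul, Matrix.mul_smul, Matrix.smul_mul, smul_sub]
  map_lie' := by
    intro x y
    apply repRing_derivation_ext
    intro a i j
    have hX : ∀ z : LieGLα k α, (repX k e α a).map (repDerivation α e z)
        = repX k e α a * blockMat k α (RepRing k e α) z - blockMat k α (RepRing k e α) z * repX k e α a := by
      intro z
      ext i j
      exact repDerivation_repX α e z a i j
    have h2 : ∀ z w : LieGLα k α, repDerivation α e z (repDerivation α e w (repX k e α a i j))
        = ((repX k e α a * blockMat k α (RepRing k e α) z - blockMat k α (RepRing k e α) z * repX k e α a)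
            * blockMat k α (RepRing k e α) w - blockMat k α (RepRing k e α) w *
          (repX k e α a * blockMat k α (RepRing k e α) z - blockMat k α (RepRing k e α) z * repX k e α a)) i j := by
      intro z w
      rw [repDerivation_repX, ← hX z, ← derivation_map_blockMat]
      rfl
    rw [Derivation.commutator_apply, h2, h2, repDerivation_repX, ← Matrix.sub_apply,
      LieRing.of_associative_ring_bracket, map_sub, map_mul, map_mul]
    refine congrFun (congrFun ?_ i) j
    simp only [sub_mul, mul_sub, mul_add, add_mul, mul_assoc]
    abel

theorem repLieAction_repX (η : LieGLα k α) (a : A) (i j : RepIndex α) :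
    (repLieAction α e : LieGLα k α →ₗ⁅k⁆ _) η (repX k e α a i j)
      = (repX k e α a * blockMat k α (RepRing k e α) η - blockMat k α (RepRing k e α) η * repX k e α a) i j :=
  repDerivation_repX α e η a i j

end Actions

end

/-! The coordinate ring R represents the functor of α-dimensional representations, so a derivation
of R amounts to a representation X + εY over R[ε], that is, to a linear family Y obeying the Leibniz
rule along X and killing the idempotents (`exists_derivation_repX`). Everything multiderivational on
R is then decided on the entries a_ij (`biderivation_eq_zero_of_generators`,
`cyclic_eq_zero_of_generators`).

The bracket is built one variable at a time. The Leibniz rule of the double bracket gives the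
derivations {a_ij, -}; antisymmetry turns the same rule into a Leibniz rule in a, so that each value
{-, y} extends as well (`exists_isInducedBracket`).

For the Jacobi identity, both sides are cyclic and are derivations in each argument. On entries the
Jacobiator is an entry of the triple bracket of (a, b, c) minus one of (a, c, b)
(`IsInducedBracket.jacobiator`). The matrix unit E_pq acts by the commutator X E_pq - E_pq X, so the
cyclic sum C(a, c, b) of products (E_pq a)(E_qr c)(E_rp b) expands into 2³ terms, and these are
exactly the eight terms of the double quasi-Poisson condition (`cyclicUnitSum_repX`). On the other
side, the Cartan trivector can be computed in any pair of dual families (`cartanTrivector_eq_sum`);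
with E_pq dual to E_qp, half of its evaluation is (C(a, c, b) - C(a, b, c))/4
(`half_trivectorEval_cartanTrivector`), and the two sides agree.

Invariance under the Lie algebra is checked on entries. Invariance under the group follows from
uniqueness, the transported bracket being induced by the same double bracket. The Cartan trivector
is fixed because Ad g carries dual families to dual families. -/

set_option linter.unusedSectionVars false

/-! ### Derivations and brackets on the coordinate ring -/

noncomputable section InducedBracket

variable {k : Type*} [Field k] {A : Type*} [Ring A] [Algebra k A]
variable {I : Type*} [Fintype I] [DecidableEq I] (e : I → A) (α : I → ℕ)

/-- The matrix `X + ε Y` over the dual numbers. -/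
def dualNumberMatrix {R : Type*} [CommRing R] [Algebra k R] {n : Type*}
    (X Y : A →ₗ[k] Matrix n n R) : A →ₗ[k] Matrix n n (DualNumber R) where
  toFun a := Matrix.of fun i j => TrivSqZeroExt.inl (X a i j) + TrivSqZeroExt.inr (Y a i j)
  map_add' a b := by
    ext i j : 1
    apply TrivSqZeroExt.ext <;> simp
  map_smul' t a := by
    ext i j : 1
    apply TrivSqZeroExt.ext <;> simp

theorem dualNumberMatrix_apply {R : Type*} [CommRing R] [Algebra k R] {n : Type*}
    (X Y : A →ₗ[k] Matrix n n R) (a : A) (i j : n) :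
    dualNumberMatrix X Y a i j = TrivSqZeroExt.inl (X a i j) + TrivSqZeroExt.inr (Y a i j) := rfl

/-- Since ε² = 0, the constant term of the product is multiplicativity of X and the ε-term is the
Leibniz rule for Y. -/
theorem dualNumberMatrix_mul {R : Type*} [CommRing R] [Algebra k R] {n : Type*} [Fintype n]
    (X Y : A →ₗ[k] Matrix n n R) {a b : A} (hX : X (a * b) = X a * X b)
    (hY : Y (a * b) = X a * Y b + Y a * X b) :
    dualNumberMatrix X Y (a * b) = dualNumberMatrix X Y a * dualNumberMatrix X Y b := by
  ext i j : 1
  rw [Matrix.mul_apply, dualNumberMatrix_apply, hX, hY]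
  simp only [dualNumberMatrix_apply]
  apply TrivSqZeroExt.ext
  · simp [Matrix.mul_apply, TrivSqZeroExt.fst_sum]
  · simp [Matrix.mul_apply, TrivSqZeroExt.snd_sum, Finset.sum_add_distrib, mul_comm]

/-- A section of `fst : R[ε] → R` defines a derivation. -/
def derivationOfDualNumber {R : Type*} [CommRing R] [Algebra k R] (F : R →ₐ[k] DualNumber R)
    (hF : ∀ x, (F x).fst = x) : Derivation k R R :=
  Derivation.mk' ((TrivSqZeroExt.sndHom R R).restrictScalars k ∘ₗ F.toLinearMap) fun x y => by
    simp [hF, mul_comm]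

theorem derivationOfDualNumber_apply {R : Type*} [CommRing R] [Algebra k R]
    (F : R →ₐ[k] DualNumber R) (hF : ∀ x, (F x).fst = x) (x : R) :
    derivationOfDualNumber F hF x = (F x).snd := rfl

theorem derivation_sum_apply {R ι : Type*} [CommRing R] [Algebra k R] (s : Finset ι)
    (f : ι → Derivation k R R) (x : R) : (∑ p ∈ s, f p) x = ∑ p ∈ s, f p x := by
  rw [← Derivation.coeFnAddMonoidHom_apply, map_sum, Finset.sum_apply]
  rfl

variable (k) in
/-- The matrix `X(a)`, as a linear function of `a`. -/
def repXₗ : A →ₗ[k] Matrix (RepIndex α) (RepIndex α) (RepRing k e α) where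
  toFun := repX k e α
  map_add' := repX_add e α
  map_smul' := repX_smul e α

theorem blockId_map_inl (S : Type*) [CommRing S] (s : I) :
    (blockId S α s).map TrivSqZeroExt.inl = blockId (DualNumber S) α s := by
  ext i j : 1
  simp only [blockId, Matrix.map_apply, Matrix.of_apply]
  split_ifs
  · exact TrivSqZeroExt.inl_one (R := S) (M := S)
  · exact TrivSqZeroExt.inl_zero (R := S) (M := S)

theorem exists_algHom_dualNumber {R : Type*} [CommRing R] [Algebra k R]
    (X Y : A →ₗ[k] Matrix (RepIndex α) (RepIndex α) R)
    (hX : ∀ a b, X (a * b) = X a * X b) (hXe : ∀ s, X (e s) = blockId R α s)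
    (hY : ∀ a b, Y (a * b) = X a * Y b + Y a * X b) (hYe : ∀ s, Y (e s) = 0) :
    ∃ F : RepRing k e α →ₐ[k] DualNumber R,
      ∀ a i j, F (repX k e α a i j)
        = TrivSqZeroExt.inl (X a i j) + TrivSqZeroExt.inr (Y a i j) := by
  refine ⟨repLift e α (dualNumberMatrix X Y)
    (fun a b => dualNumberMatrix_mul X Y (hX a b) (hY a b)) (fun s => ?_), fun a i j => ?_⟩
  · rw [← blockId_map_inl, ← hXe]
    ext i j : 1
    rw [dualNumberMatrix_apply, hYe, Matrix.zero_apply, TrivSqZeroExt.inr_zero, add_zero]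
    rfl
  · rw [repLift_repX, dualNumberMatrix_apply]

/-- A linear family of matrices satisfying the Leibniz rule and vanishing at the idempotents
extends to a derivation of `O(Rep(A, α))`. -/
theorem exists_derivation_repX
    (Y : A →ₗ[k] Matrix (RepIndex α) (RepIndex α) (RepRing k e α))
    (hmul : ∀ a b, Y (a * b) = repX k e α a * Y b + Y a * repX k e α b)
    (hid : ∀ s, Y (e s) = 0) :
    ∃ D : Derivation k (RepRing k e α) (RepRing k e α),
      ∀ a i j, D (repX k e α a i j) = Y a i j := by
  obtain ⟨F, hF⟩ := exists_algHom_dualNumber e α (repXₗ k e α) Y (repX_mul e α) (repX_idem e α)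
    hmul hid
  -- Setting ε = 0 gives back X, so F is a section of R[ε] → R and its ε-part is a derivation.
  have hfst : ∀ x, (F x).fst = x := by
    have : (TrivSqZeroExt.fstHom k (RepRing k e α) (RepRing k e α)).comp F
        = AlgHom.id k (RepRing k e α) := by
      apply repRing_algHom_ext
      intro a i j
      rw [AlgHom.comp_apply, hF, map_add, TrivSqZeroExt.fstHom_apply,
        TrivSqZeroExt.fstHom_apply, TrivSqZeroExt.fst_inl, TrivSqZeroExt.fst_inr, add_zero,
        AlgHom.id_apply]
      rfl
    exact fun x => DFunLike.congr_fun this x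
  refine ⟨derivationOfDualNumber F hfst, fun a i j => ?_⟩
  rw [derivationOfDualNumber_apply, hF, TrivSqZeroExt.snd_add, TrivSqZeroExt.snd_inl,
    TrivSqZeroExt.snd_inr, zero_add]

/-- The derivation `br a` given by an antisymmetric biderivation `br`. -/
def IsAntisymmBiderivation.ad {R : Type*} [CommRing R] [Algebra k R] {br : R →ₗ[k] R →ₗ[k] R}
    (h : IsAntisymmBiderivation br) (a : R) : Derivation k R R :=
  Derivation.mk' (br a) fun x y => by
    rw [h.leibniz, smul_eq_mul, smul_eq_mul]; ring

theorem IsAntisymmBiderivation.ad_apply {R : Type*} [CommRing R] [Algebra k R]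
    {br : R →ₗ[k] R →ₗ[k] R} (h : IsAntisymmBiderivation br) (a x : R) : h.ad a x = br a x := rfl

variable {e α}

/-- A symmetric or antisymmetric map which is a derivation in each argument is determined by its values on
generators. -/
theorem biderivation_eq_zero_of_generators (H : RepRing k e α → RepRing k e α → RepRing k e α)
    (hsymm : ∀ x y, H x y = 0 → H y x = 0)
    (hder : ∀ x, ∃ D : Derivation k (RepRing k e α) (RepRing k e α), ∀ y, H x y = D y)
    (hgen : ∀ a i j b l m, H (repX k e α a i j) (repX k e α b l m) = 0) (x y) : H x y = 0 := by
  have key : ∀ x, (∀ b l m, H x (repX k e α b l m) = 0) → ∀ y, H x y = 0 := by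
    intro x hx y
    obtain ⟨D, hD⟩ := hder x
    have : D = 0 := repRing_derivation_ext e α fun b l m => by
      rw [← hD, hx, Derivation.zero_apply]
    rw [hD, this, Derivation.zero_apply]
  refine key x (fun b l m => ?_) y
  exact hsymm _ _ (key _ (fun a i j => hgen b l m a i j) x)

/-- A cyclically invariant map which is a derivation in each argument is determined by its values
on generators. -/
theorem cyclic_eq_zero_of_generators
    (H : RepRing k e α → RepRing k e α → RepRing k e α → RepRing k e α)
    (hcyc : ∀ x y z, H x y z = H y z x)
    (hder : ∀ y z, ∃ D : Derivation k (RepRing k e α) (RepRing k e α), ∀ x, H x y z = D x)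
    (hgen : ∀ a i j b l m c n o,
      H (repX k e α a i j) (repX k e α b l m) (repX k e α c n o) = 0) (x y z) : H x y z = 0 := by
  have key : ∀ y z, (∀ a i j, H (repX k e α a i j) y z = 0) → ∀ x, H x y z = 0 := by
    intro y z h x
    obtain ⟨D, hD⟩ := hder y z
    have : D = 0 := repRing_derivation_ext e α fun b l m => by
      rw [← hD, h, Derivation.zero_apply]
    rw [hD, this, Derivation.zero_apply]
  -- One slot is reduced to generators at a time, and the cyclic symmetry brings the next slot to
  -- the front.
  refine key y z (fun a i j => ?_) x
  rw [hcyc]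
  refine key z _ (fun b l m => ?_) y
  rw [hcyc]
  exact key _ _ (fun c n o => by rw [hcyc]; exact hgen _ _ _ _ _ _ _ _ _) z

/-! ### Entries of tensors -/

theorem repEntry₂_tmul (i j l m : RepIndex α) (x y : A) :
    repEntry₂ k e α i j l m (x ⊗ₜ y) = repX k e α x i j * repX k e α y l m := rfl

theorem repEntry₂_comm (i j l m : RepIndex α) (t : A ⊗[k] A) :
    repEntry₂ k e α i j l m (TensorProduct.comm k A A t) = repEntry₂ k e α l m i j t := by
  induction t using TensorProduct.induction_on with
  | zero => simp
  | tmul x y => rw [TensorProduct.comm_tmul, repEntry₂_tmul, repEntry₂_tmul, mul_comm]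
  | add x y hx hy => rw [map_add, map_add, map_add, hx, hy]

theorem repEntry₂_mul_right (i j l m : RepIndex α) (t : A ⊗[k] A) (c : A) :
    repEntry₂ k e α i j l m (t * (1 ⊗ₜ[k] c))
      = ∑ p, repEntry₂ k e α i j l p t * repX k e α c p m := by
  induction t using TensorProduct.induction_on with
  | zero => simp
  | tmul x y =>
    rw [Algebra.TensorProduct.tmul_mul_tmul, mul_one, repEntry₂_tmul, repX_mul, Matrix.mul_apply,
      Finset.mul_sum]
    simp only [repEntry₂_tmul, mul_assoc]
  | add x y hx hy => simp only [add_mul, map_add, hx, hy, Finset.sum_add_distrib]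

theorem repEntry₂_mul_left (i j l m : RepIndex α) (t : A ⊗[k] A) (b : A) :
    repEntry₂ k e α i j l m ((b ⊗ₜ[k] 1) * t)
      = ∑ p, repX k e α b i p * repEntry₂ k e α p j l m t := by
  induction t using TensorProduct.induction_on with
  | zero => simp
  | tmul x y =>
    rw [Algebra.TensorProduct.tmul_mul_tmul, one_mul, repEntry₂_tmul, repX_mul, Matrix.mul_apply,
      Finset.sum_mul]
    simp only [repEntry₂_tmul, mul_assoc]
  | add x y hx hy => simp only [mul_add, map_add, hx, hy, Finset.sum_add_distrib]

/-! ### Existence and uniqueness of the induced bracket -/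

variable {dbr : A →ₗ[k] A →ₗ[k] A ⊗[k] A}

/-- Used to derive a Leibniz rule in the first argument from the one assumed in the second. -/
theorem repEntry₂_dbr_swap (h : IsDoubleBracket e dbr) (a b : A) (i j l m : RepIndex α) :
    repEntry₂ k e α i j l m (dbr a b) = -repEntry₂ k e α l m i j (dbr b a) := by
  rw [h.antisymm a b, map_neg, repEntry₂_comm]

theorem repEntry₂_dbr_mul (h : IsDoubleBracket e dbr) (a b c : A) (i j l m : RepIndex α) :
    repEntry₂ k e α i j l m (dbr a (b * c))
      = ∑ p, repX k e α b i p * repEntry₂ k e α p j l m (dbr a c)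
        + ∑ p, repEntry₂ k e α i j l p (dbr a b) * repX k e α c p m := by
  rw [h.leibniz, map_add, repEntry₂_mul_left, repEntry₂_mul_right, add_comm]

/-- The derivation `{a_ij, -}`. -/
theorem exists_derivation_dbr (h : IsDoubleBracket e dbr) (a : A) (i j : RepIndex α) :
    ∃ D : Derivation k (RepRing k e α) (RepRing k e α),
      ∀ b l m, D (repX k e α b l m) = repEntry₂ k e α l j i m (dbr a b) := by
  refine exists_derivation_repX e α
    { toFun := fun b => Matrix.of fun l m => repEntry₂ k e α l j i m (dbr a b)
      map_add' := fun b c => by ext l m : 1; simp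
      map_smul' := fun t b => by ext l m : 1; simp } (fun b c => ?_) (fun s => ?_)
  · ext l m : 1
    simp [Matrix.mul_apply, repEntry₂_dbr_mul h]
  · ext l m : 1
    simp [h.right_base (e s) (Submodule.subset_span ⟨s, rfl⟩) a]

theorem IsInducedBracket.unique {br br' : RepRing k e α →ₗ[k] RepRing k e α →ₗ[k] RepRing k e α}
    (h : IsInducedBracket e α dbr br) (h' : IsInducedBracket e α dbr br') : br' = br := by
  refine LinearMap.ext₂ fun x y => sub_eq_zero.mp ?_
  refine biderivation_eq_zero_of_generators (fun x y => br' x y - br x y) (fun x y hxy => ?_)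
    (fun x => ?_) (fun a i j b l m => ?_) x y
  · rw [h.biderivation.antisymm y x, h'.biderivation.antisymm y x]
    linear_combination -hxy
  · exact ⟨h'.biderivation.ad x - h.biderivation.ad x, fun y => rfl⟩
  · exact sub_eq_zero.mpr ((h'.on_generators ..).trans (h.on_generators ..).symm)

/-- The second variable is extended from entries to all of R first, then the first one, each time as
a derivation; antisymmetry is recovered afterwards by comparison on entries. -/
theorem exists_isInducedBracket (h : IsDoubleBracket e dbr) (α : I → ℕ) :
    ∃ br, IsInducedBracket e α dbr br := by
  choose D hD using exists_derivation_dbr (α := α) h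
  have hadd : ∀ a b i j, D (a + b) i j = D a i j + D b i j := fun a b i j =>
    repRing_derivation_ext e α fun c l m => by simp [hD]
  have hsmul : ∀ (t : k) a i j, D (t • a) i j = t • D a i j := fun t a i j =>
    repRing_derivation_ext e α fun c l m => by simp [hD]
  -- This is the relation (ab)_ij = ∑ a_ip b_pj seen in the first slot; it is what makes a ↦ {a_ij,
  -- y} a derivation along X for every fixed y.
  have hmul : ∀ a b i j, D (a * b) i j
      = ∑ p, repX k e α a i p • D b p j + ∑ p, repX k e α b p j • D a i p := fun a b i j =>
    repRing_derivation_ext e α fun c l m => by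
      rw [Derivation.add_apply, derivation_sum_apply, derivation_sum_apply]
      simp only [Derivation.smul_apply, smul_eq_mul, hD]
      rw [repEntry₂_dbr_swap h, repEntry₂_dbr_mul h]
      simp only [repEntry₂_dbr_swap h c, neg_add, ← Finset.sum_neg_distrib]
      congr 1 <;> refine Finset.sum_congr rfl fun p _ => by ring
  have hbase : ∀ s i j, D (e s) i j = 0 := fun s i j =>
    repRing_derivation_ext e α fun c l m => by
      simp [hD, h.left_base (e s) (Submodule.subset_span ⟨s, rfl⟩) c]
  have hE : ∀ y, ∃ E : Derivation k (RepRing k e α) (RepRing k e α),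
      ∀ a i j, E (repX k e α a i j) = D a i j y := by
    intro y
    refine exists_derivation_repX e α
      { toFun := fun a => Matrix.of fun i j => D a i j y
        map_add' := fun b c => by ext l m : 1; simp [hadd]
        map_smul' := fun t b => by ext l m : 1; simp [hsmul] } (fun b c => ?_) (fun s => ?_)
    · ext l m : 1
      simp only [LinearMap.coe_mk, AddHom.coe_mk, Matrix.of_apply, hmul, Matrix.add_apply,
        Matrix.mul_apply, Derivation.add_apply, derivation_sum_apply, Derivation.smul_apply,
        smul_eq_mul]
      congr 1
      exact Finset.sum_congr rfl fun p _ => mul_comm _ _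
    · ext l m : 1
      simp [hbase]
  choose E hE using hE
  -- `E y` stands for {-, y}, so it is applied to the first argument.
  let br : RepRing k e α →ₗ[k] RepRing k e α →ₗ[k] RepRing k e α :=
    LinearMap.mk₂ k (fun x y => E y x) (fun x x' y => map_add _ _ _)
      (fun t x y => (E y).map_smul t x)
      (fun x y y' => by
        have : E (y + y') = E y + E y' := repRing_derivation_ext e α fun a i j => by simp [hE]
        rw [this]; rfl)
      (fun t x y => by
        have : E (t • y) = t • E y := repRing_derivation_ext e α fun a i j => by simp [hE]
        rw [this]; rfl)
  have hbr : ∀ x y, br x y = E y x := fun _ _ => rfl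
  have hleib : ∀ x y z, br x (y * z) = br x y * z + y * br x z := by
    intro x y z
    have : E (y * z) = y • E z + z • E y := repRing_derivation_ext e α fun a i j => by simp [hE]
    rw [hbr, hbr, hbr, this]
    simp; ring
  have hgen : ∀ (a b : A) (i j l m : RepIndex α),
      br (repX k e α a i j) (repX k e α b l m) = repEntry₂ k e α l j i m (dbr a b) := by
    intro a b i j l m
    rw [hbr, hE, hD]
  refine ⟨br, ⟨fun x y => ?_, hleib⟩, hgen⟩
  refine eq_neg_of_add_eq_zero_left ?_
  refine biderivation_eq_zero_of_generators (fun x y => br x y + br y x)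
    (fun x y hxy => by rw [add_comm]; exact hxy) (fun x => ?_) (fun a i j b l m => ?_) x y
  · exact ⟨Derivation.mk' (br x) (fun y z => by
      rw [hleib, smul_eq_mul, smul_eq_mul]; ring) + E x, fun y => rfl⟩
  · rw [hgen, hgen, repEntry₂_dbr_swap h, neg_add_cancel]

end InducedBracket

/-! ### The Cartan trivector through dual families -/

noncomputable section CartanTrivector

variable {k : Type*} [Field k]

/-- An alternating map of three variables as a trilinear map. -/
def AlternatingMap.curry₃ {V M : Type*} [AddCommGroup V] [Module k V] [AddCommGroup M] [Module k M]
    (f : V [⋀^Fin 3]→ₗ[k] M) : V →ₗ[k] V →ₗ[k] V →ₗ[k] M :=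
  LinearMap.mk₂ k (fun x y =>
      { toFun := fun z => ((f.curryLeft x).curryLeft y).curryLeft z ![]
        map_add' := fun z z' => by rw [map_add]; rfl
        map_smul' := fun t z => by rw [map_smul]; rfl })
    (fun x x' y => by ext z; simp [-AlternatingMap.curryLeft_apply_apply, AlternatingMap.curryLeft_add])
    (fun t x y => by ext z; simp [-AlternatingMap.curryLeft_apply_apply, AlternatingMap.curryLeft_smul])
    (fun x y y' => by ext z; simp [-AlternatingMap.curryLeft_apply_apply, AlternatingMap.curryLeft_add])
    (fun t x y => by ext z; simp [-AlternatingMap.curryLeft_apply_apply, AlternatingMap.curryLeft_smul])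

theorem AlternatingMap.curry₃_apply {V M : Type*} [AddCommGroup V] [Module k V] [AddCommGroup M]
    [Module k M] (f : V [⋀^Fin 3]→ₗ[k] M) (x y z : V) : f.curry₃ x y z = f ![x, y, z] := rfl

variable {L : Type*} [LieRing L] [LieAlgebra k L]

/-- Two families which are dual to each other for the bilinear form `κ`. -/
structure IsDualPair (κ : LinearMap.BilinForm k L) {ι : Type*} [Fintype ι] (u v : ι → L) :
    Prop where
  sum_left : ∀ w, ∑ i, κ (v i) w • u i = w
  sum_right : ∀ w, ∑ i, κ w (u i) • v i = w

variable {κ : LinearMap.BilinForm k L}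

/-- The element ∑ v_i ⊗ u_i is canonical: expand u_i in the second family, then collect the
coefficients on the v_i, where they reassemble v'_j. -/
theorem IsDualPair.sum_eq {ι ι' : Type*} [Fintype ι] [Fintype ι'] {u v : ι → L} {u' v' : ι' → L}
    (h : IsDualPair κ u v) (h' : IsDualPair κ u' v') {M : Type*} [AddCommGroup M] [Module k M]
    (B : L →ₗ[k] L →ₗ[k] M) : ∑ i, B (v i) (u i) = ∑ j, B (v' j) (u' j) := by
  calc ∑ i, B (v i) (u i) = ∑ i, ∑ j, κ (v' j) (u i) • B (v i) (u' j) :=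
        Finset.sum_congr rfl fun i _ => by
          conv_lhs => rw [← h'.sum_left (u i), map_sum]
          simp only [map_smul]
    _ = ∑ j, B (∑ i, κ (v' j) (u i) • v i) (u' j) := by
        rw [Finset.sum_comm]
        simp only [map_sum, map_smul, LinearMap.sum_apply, LinearMap.smul_apply]
    _ = _ := by simp only [h.sum_right]

theorem isDualPair_dualBasis [FiniteDimensional k L] (hκ : κ.Nondegenerate)
    (hsymm : ∀ x y, κ x y = κ y x) {ι : Type*} [Fintype ι] [DecidableEq ι]
    (b : Module.Basis ι k L) : IsDualPair κ b (κ.dualBasis hκ b) where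
  sum_left w := by
    have h := (κ.dualBasis hκ (κ.dualBasis hκ b)).sum_repr w
    rw [LinearMap.BilinForm.dualBasis_dualBasis hκ ⟨hsymm⟩] at h
    have h2 : ∀ i, b.repr w i = κ (κ.dualBasis hκ b i) w := fun i => by
      conv_lhs => rw [← LinearMap.BilinForm.dualBasis_dualBasis hκ ⟨hsymm⟩ b]
      rw [LinearMap.BilinForm.dualBasis_repr_apply, hsymm]
    simpa only [h2] using h
  sum_right w := by
    have h := (κ.dualBasis hκ b).sum_repr w
    simpa only [LinearMap.BilinForm.dualBasis_repr_apply] using h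

/-- The sum over i of the coefficients (ε^i | [ε^j, ε^l]) against ε_i collapses to the bracket
itself. What remains is bilinear in each pair (ε^j, ε_j), (ε^l, ε_l), so each basis can be exchanged
for the given families. -/
theorem cartanTrivector_eq_sum [FiniteDimensional k L] (hκ : κ.Nondegenerate)
    (hsymm : ∀ x y, κ x y = κ y x) {ι : Type*} [Fintype ι] {u v : ι → L} (h : IsDualPair κ u v) :
    cartanTrivector κ hκ = (1 / 12 : k) • ∑ j, ∑ l,
      exteriorPower.ιMulti k 3 ![⁅v j, v l⁆, u j, u l] := by
  set W := (exteriorPower.ιMulti k 3 (M := L)).curry₃ with hW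
  have hWa : ∀ x y z, exteriorPower.ιMulti k 3 ![x, y, z] = W x y z := fun _ _ _ => rfl
  have hd := isDualPair_dualBasis hκ hsymm (Module.finBasis k L)
  simp only [cartanTrivector, hWa]
  congr 1
  set ε := Module.finBasis k L
  set ε' := κ.dualBasis hκ ε
  calc _ = ∑ j, ∑ l, W (∑ i, κ (ε' i) ⁅ε' j, ε' l⁆ • ε i) (ε j) (ε l) := by
        rw [Finset.sum_comm]
        refine Finset.sum_congr rfl fun j _ => ?_
        rw [Finset.sum_comm]
        simp only [map_sum, map_smul, LinearMap.sum_apply, LinearMap.smul_apply]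
    _ = ∑ j, ∑ l, W ⁅ε' j, ε' l⁆ (ε j) (ε l) := by simp only [hd.sum_left]
    -- The index l is exchanged with j held fixed, and j afterwards.
    _ = ∑ j, ∑ l, W ⁅ε' j, v l⁆ (ε j) (u l) := Finset.sum_congr rfl fun j _ =>
        hd.sum_eq h (LinearMap.mk₂ k (fun x y => W ⁅ε' j, x⁆ (ε j) y) (by simp) (by simp) (by simp)
          (by simp))
    _ = ∑ l, ∑ j, W ⁅ε' j, v l⁆ (ε j) (u l) := Finset.sum_comm
    _ = ∑ l, ∑ j, W ⁅v j, v l⁆ (u j) (u l) := Finset.sum_congr rfl fun l _ =>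
        hd.sum_eq h (LinearMap.mk₂ k (fun x y => W ⁅x, v l⁆ y (u l)) (by simp) (by simp) (by simp)
          (by simp))
    _ = _ := Finset.sum_comm

/-- As ψ is both adjoint and right inverse to φ, the images under φ of dual families are dual again;
the trivector computed in them is the image of the original one because φ respects brackets. -/
theorem map_cartanTrivector [FiniteDimensional k L] (hκ : κ.Nondegenerate)
    (hsymm : ∀ x y, κ x y = κ y x) (φ ψ : Module.End k L) (hφ : ∀ x y, φ ⁅x, y⁆ = ⁅φ x, φ y⁆)
    (hφψ : ∀ x, φ (ψ x) = x) (hκφ : ∀ x y, κ (φ x) y = κ x (ψ y)) :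
    exteriorPower.map 3 φ (cartanTrivector κ hκ) = cartanTrivector κ hκ := by
  have hd := isDualPair_dualBasis hκ hsymm (Module.finBasis k L)
  set ε := Module.finBasis k L
  set ε' := κ.dualBasis hκ ε
  have hd' : IsDualPair κ (fun i => φ (ε i)) (fun i => φ (ε' i)) :=
    { sum_left := fun w => by
        simp only [hκφ, ← map_smul, ← map_sum, hd.sum_left, hφψ]
      sum_right := fun w => by
        simp only [hsymm w, hκφ]
        simp only [hsymm _ (ψ w), ← map_smul, ← map_sum, hd.sum_right, hφψ] }
  conv_rhs => rw [cartanTrivector_eq_sum hκ hsymm hd']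
  rw [cartanTrivector_eq_sum hκ hsymm hd]
  simp only [map_smul, map_sum, exteriorPower.map_apply_ιMulti]
  congr 1
  refine Finset.sum_congr rfl fun j _ => Finset.sum_congr rfl fun l _ => ?_
  congr 1
  ext i
  fin_cases i <;> simp [hφ]

variable {R : Type*} [CommRing R] [Algebra k R]

/-- The alternatization is the Leibniz expansion of a 3 × 3 determinant, rows indexed by the Lie
algebra elements and columns by the functions. -/
theorem trivectorEval_ιMulti (act : L →ₗ⁅k⁆ Derivation k R R) (a b c : R) (x y z : L) :
    trivectorEval act a b c (exteriorPower.ιMulti k 3 ![x, y, z])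
      = act x a * act y b * act z c - act x a * act z b * act y c
        - act y a * act x b * act z c + act y a * act z b * act x c
        + act z a * act x b * act y c - act z a * act y b * act x c := by
  have h : trivectorEval act a b c (exteriorPower.ιMulti k 3 ![x, y, z])
      = (Matrix.of fun i j => act ((![x, y, z] : Fin 3 → L) i) ((![a, b, c] : Fin 3 → R) j)).det := by
    rw [trivectorEval, exteriorPower.alternatingMapLinearEquiv_apply_ιMulti,
      MultilinearMap.alternatization_apply, Matrix.det_apply]
    rfl
  rw [h, Matrix.det_fin_three]
  simp only [Matrix.of_apply, Matrix.cons_val]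
  ring

end CartanTrivector

/-! ### The trace form and the Cartan trivector of `𝔤_α` -/

noncomputable section MatrixUnits

variable {k : Type*} [Field k] {I : Type*} [Fintype I] [DecidableEq I] {α : I → ℕ}

theorem traceFormα_apply (η ξ : LieGLα k α) : traceFormα k α η ξ = ∑ s, (η s * ξ s).trace := rfl

theorem traceFormα_symm (η ξ : LieGLα k α) : traceFormα k α η ξ = traceFormα k α ξ η := by
  rw [traceFormα_apply, traceFormα_apply]
  exact Finset.sum_congr rfl fun s _ => Matrix.trace_mul_comm _ _

theorem traceFormα_invariant (x y z : LieGLα k α) :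
    traceFormα k α x ⁅y, z⁆ = traceFormα k α ⁅x, y⁆ z := by
  rw [traceFormα_apply, traceFormα_apply]
  refine Finset.sum_congr rfl fun s _ => ?_
  rw [LieRing.of_associative_ring_bracket, LieRing.of_associative_ring_bracket, Pi.sub_apply,
    Pi.sub_apply, Pi.mul_apply, Pi.mul_apply, Pi.mul_apply, Pi.mul_apply, mul_sub, sub_mul,
    Matrix.trace_sub, Matrix.trace_sub, mul_assoc, ← mul_assoc (x s) (z s), Matrix.trace_mul_comm _ (y s),
    mul_assoc]

variable (k) in
/-- The matrix unit `E_pq` in the `s`-th factor of `𝔤_α`. -/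
def glUnit (s : I) (p q : Fin (α s)) : LieGLα k α := Pi.single s (Matrix.single p q 1)

theorem traceFormα_glUnit (s : I) (p q : Fin (α s)) (w : LieGLα k α) :
    traceFormα k α (glUnit k s p q) w = w s q p := by
  rw [traceFormα_apply, Finset.sum_eq_single s]
  · rw [glUnit, Pi.single_eq_same, Matrix.trace_single_mul]
    exact one_mul _
  · intro t _ h
    rw [glUnit, Pi.single_eq_of_ne h, zero_mul, Matrix.trace_zero]
  · simp

theorem sum_smul_glUnit (w : LieGLα k α) :
    ∑ x : Σ s, Fin (α s) × Fin (α s), w x.1 x.2.1 x.2.2 • glUnit k x.1 x.2.1 x.2.2 = w := by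
  rw [Fintype.sum_sigma]
  ext t i j
  rw [Finset.sum_apply, Matrix.sum_apply, Finset.sum_eq_single t]
  · simp only [Finset.sum_apply, Matrix.sum_apply, Fintype.sum_prod_type, Pi.smul_apply, glUnit,
      Pi.single_eq_same, Matrix.smul_apply, Matrix.single_apply, smul_eq_mul, mul_ite, mul_one,
      mul_zero, ite_and, Finset.sum_ite_irrel, Finset.sum_const_zero, Finset.sum_ite_eq',
      Finset.mem_univ, if_true]
  · intro s _ h
    simp [glUnit, Pi.single_eq_of_ne h.symm]
  · simp

theorem isDualPair_glUnit : IsDualPair (traceFormα k α)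
    (fun x : Σ s, Fin (α s) × Fin (α s) => glUnit k x.1 x.2.1 x.2.2)
    (fun x => glUnit k x.1 x.2.2 x.2.1) where
  sum_left w := by
    simp only [traceFormα_glUnit]
    exact sum_smul_glUnit w
  sum_right w := by
    simp only [traceFormα_symm w, traceFormα_glUnit]
    refine Eq.trans ?_ (sum_smul_glUnit w)
    exact Fintype.sum_equiv (Equiv.sigmaCongrRight fun s => Equiv.prodComm _ _) _ _ fun x => rfl

theorem traceFormα_nondegenerate : (traceFormα k α).Nondegenerate := by
  have h : ∀ x, (∀ y, traceFormα k α y x = 0) → x = 0 := fun x hx => by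
    ext s i j
    rw [← traceFormα_glUnit s j i x, hx]
    rfl
  exact ⟨fun x hx => h x fun y => by rw [traceFormα_symm, hx], h⟩

theorem adjointα_apply (g : GLα k α) (η : LieGLα k α) :
    adjointα k α g η = g.toLie * η * g⁻¹.toLie := rfl

theorem GLα.toLie_mul_inv (g : GLα k α) : g.toLie * g⁻¹.toLie = 1 := by
  rw [← GLα.toLie_mul, mul_inv_cancel, GLα.toLie_one]

theorem GLα.toLie_inv_mul (g : GLα k α) : g⁻¹.toLie * g.toLie = 1 := by
  rw [← GLα.toLie_mul, inv_mul_cancel, GLα.toLie_one]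

theorem adjointα_mul (g : GLα k α) (x y : LieGLα k α) :
    adjointα k α g (x * y) = adjointα k α g x * adjointα k α g y := by
  simp only [adjointα_apply]
  calc _ = g.toLie * x * 1 * y * g⁻¹.toLie := by simp only [mul_assoc, one_mul]
    _ = _ := by rw [← GLα.toLie_inv_mul g]; simp only [mul_assoc]

theorem adjointα_lie (g : GLα k α) (x y : LieGLα k α) :
    adjointα k α g ⁅x, y⁆ = ⁅adjointα k α g x, adjointα k α g y⁆ := by
  simp only [LieRing.of_associative_ring_bracket, map_sub, adjointα_mul]

theorem adjointα_adjointα_inv (g : GLα k α) (x : LieGLα k α) :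
    adjointα k α g (adjointα k α g⁻¹ x) = x := by
  rw [← Module.End.mul_apply, ← map_mul, mul_inv_cancel, map_one, Module.End.one_apply]

theorem traceFormα_adjointα (g : GLα k α) (x y : LieGLα k α) :
    traceFormα k α (adjointα k α g x) y = traceFormα k α x (adjointα k α g⁻¹ y) := by
  simp only [adjointα_apply, traceFormα_apply, inv_inv, Pi.mul_apply]
  refine Finset.sum_congr rfl fun s _ => ?_
  rw [mul_assoc, mul_assoc, Matrix.trace_mul_comm]
  simp only [mul_assoc]

/-- E_qp annihilates every unit on its right except those of row p in the same block, so a single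
free index r survives. -/
theorem sum_glUnit_mul {M : Type*} [AddCommGroup M] [Module k M]
    (F : LieGLα k α →ₗ[k] LieGLα k α →ₗ[k] M) (s : I) (q p : Fin (α s)) :
    ∑ x : Σ s, Fin (α s) × Fin (α s),
        F (glUnit k s q p * glUnit k x.1 x.2.2 x.2.1) (glUnit k x.1 x.2.1 x.2.2)
      = ∑ r, F (glUnit k s q r) (glUnit k s r p) := by
  rw [Fintype.sum_sigma, Finset.sum_eq_single s]
  · rw [Fintype.sum_prod_type]
    refine Finset.sum_congr rfl fun r _ => ?_
    rw [Finset.sum_eq_single p]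
    · simp [glUnit, ← Pi.single_mul]
    · intro t _ h
      simp [glUnit, ← Pi.single_mul, Matrix.single_mul_single_of_ne _ _ _ _ h.symm]
    · simp
  · intro t _ h
    refine Finset.sum_eq_zero fun x _ => ?_
    have : glUnit k s q p * glUnit k t x.2 x.1 = 0 := by
      ext u : 1
      by_cases hu : u = s
      · subst hu; simp [glUnit, Pi.single_eq_of_ne h.symm]
      · simp [glUnit, Pi.single_eq_of_ne hu]
    rw [this]; simp
  · simp

theorem sum_mul_glUnit {M : Type*} [AddCommGroup M] [Module k M]
    (F : LieGLα k α →ₗ[k] LieGLα k α →ₗ[k] M) (s : I) (q p : Fin (α s)) :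
    ∑ x : Σ s, Fin (α s) × Fin (α s),
        F (glUnit k x.1 x.2.2 x.2.1 * glUnit k s q p) (glUnit k x.1 x.2.1 x.2.2)
      = ∑ r, F (glUnit k s r p) (glUnit k s q r) := by
  rw [Fintype.sum_sigma, Finset.sum_eq_single s]
  · rw [Fintype.sum_prod_type, Finset.sum_comm]
    refine Finset.sum_congr rfl fun r _ => ?_
    rw [Finset.sum_eq_single q]
    · simp [glUnit, ← Pi.single_mul]
    · intro t _ h
      simp [glUnit, ← Pi.single_mul, Matrix.single_mul_single_of_ne _ _ _ _ h]
    · simp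
  · intro t _ h
    refine Finset.sum_eq_zero fun x _ => ?_
    have : glUnit k t x.2 x.1 * glUnit k s q p = 0 := by
      ext u : 1
      by_cases hu : u = s
      · subst hu; simp [glUnit, Pi.single_eq_of_ne h.symm]
      · simp [glUnit, Pi.single_eq_of_ne hu]
    rw [this]; simp
  · simp

/-- The cyclic sum `∑ (E_pq a) (E_qr b) (E_rp c)`. -/
def cyclicUnitSum {R : Type*} [CommRing R] [Algebra k R]
    (act : LieGLα k α →ₗ⁅k⁆ Derivation k R R) (a b c : R) : R :=
  ∑ s, ∑ p, ∑ q, ∑ r, act (glUnit k s p q) a * act (glUnit k s q r) b * act (glUnit k s r p) c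

/-- Each half of the commutator contributes one cyclic sum, up to renaming p, q, r. The first gets
its minus sign from a transposition of arguments, the second from the commutator: hence -2. -/
theorem sum_alternating_glUnit {M : Type*} [AddCommGroup M] [Module k M]
    (f : LieGLα k α [⋀^Fin 3]→ₗ[k] M) :
    ∑ x : Σ s, Fin (α s) × Fin (α s), ∑ y : Σ s, Fin (α s) × Fin (α s),
        f ![⁅glUnit k x.1 x.2.2 x.2.1, glUnit k y.1 y.2.2 y.2.1⁆,
          glUnit k x.1 x.2.1 x.2.2, glUnit k y.1 y.2.1 y.2.2]
      = (-2 : k) • ∑ s, ∑ p, ∑ q, ∑ r,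
        f ![glUnit k s p q, glUnit k s q r, glUnit k s r p] := by
  have hswap : ∀ x y z, f ![x, z, y] = -f ![x, y, z] := fun x y z => by
    rw [← f.map_swap ![x, y, z] (show (1 : Fin 3) ≠ 2 by decide)]
    congr 1
    ext i; fin_cases i <;> rfl
  have h1 : ∀ (s : I) (p q : Fin (α s)), ∑ y : Σ s, Fin (α s) × Fin (α s),
        f ![⁅glUnit k s q p, glUnit k y.1 y.2.2 y.2.1⁆,
          glUnit k s p q, glUnit k y.1 y.2.1 y.2.2]
      = -∑ r, f ![glUnit k s q r, glUnit k s r p, glUnit k s p q]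
        - ∑ r, f ![glUnit k s r p, glUnit k s p q, glUnit k s q r] := by
    intro s p q
    have ha := sum_glUnit_mul (f.curry₃.flip (glUnit k s p q)) s q p
    have hb := sum_mul_glUnit (f.curry₃.flip (glUnit k s p q)) s q p
    simp only [LinearMap.flip_apply] at ha hb
    simp only [LieRing.of_associative_ring_bracket, ← AlternatingMap.curry₃_apply, map_sub,
      LinearMap.sub_apply, Finset.sum_sub_distrib, ha, hb]
    congr 1
    · rw [← Finset.sum_neg_distrib]
      exact Finset.sum_congr rfl fun r _ => hswap _ _ _
  rw [Fintype.sum_sigma, Finset.smul_sum]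
  refine Finset.sum_congr rfl fun s _ => ?_
  rw [Fintype.sum_prod_type]
  simp only [h1, Finset.sum_sub_distrib, Finset.sum_neg_distrib]
  have e1 : ∑ p, ∑ q, ∑ r, f ![glUnit k s q r, glUnit k s r p, glUnit k s p q]
      = ∑ p, ∑ q, ∑ r, f ![glUnit k s p q, glUnit k s q r, glUnit k s r p] := by
    rw [Finset.sum_comm]
    exact Finset.sum_congr rfl fun _ _ => Finset.sum_comm
  have e2 : ∑ p, ∑ q, ∑ r, f ![glUnit k s r p, glUnit k s p q, glUnit k s q r]
      = ∑ p, ∑ q, ∑ r, f ![glUnit k s p q, glUnit k s q r, glUnit k s r p] := by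
    symm
    rw [Finset.sum_comm]
    exact Finset.sum_congr rfl fun _ _ => Finset.sum_comm
  rw [e1, e2, neg_smul, two_smul]
  abel

/-- The six terms of the determinant are three rotations of each of two cyclic sums of opposite
signs, giving a factor 3; the constant is 1/2 · 1/12 · (-2) · 3 = -1/4. -/
theorem half_trivectorEval_cartanTrivector [CharZero k] {R : Type*} [CommRing R] [Algebra k R]
    (act : LieGLα k α →ₗ⁅k⁆ Derivation k R R)
    (hκ : (traceFormα k α).Nondegenerate) (a b c : R) :
    (1 / 2 : k) • trivectorEval act a b c (cartanTrivector (traceFormα k α) hκ)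
      = (1 / 4 : k) • (cyclicUnitSum act a c b - cyclicUnitSum act a b c) := by
  have hf := sum_alternating_glUnit (((trivectorEval act a b c).compAlternatingMap
    (exteriorPower.ιMulti k 3 (M := LieGLα k α))))
  simp only [LinearMap.compAlternatingMap_apply, trivectorEval_ιMulti] at hf
  rw [cartanTrivector_eq_sum hκ traceFormα_symm isDualPair_glUnit, map_smul]
  simp only [map_sum, trivectorEval_ιMulti]
  rw [hf]
  have rot : ∀ (s : I) (F : Fin (α s) → Fin (α s) → Fin (α s) → R),
      ∑ p, ∑ q, ∑ r, F p q r = ∑ p, ∑ q, ∑ r, F q r p := by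
    intro s F
    symm
    rw [Finset.sum_comm]
    exact Finset.sum_congr rfl fun _ _ => Finset.sum_comm
  have key : ∑ s, ∑ p, ∑ q, ∑ r, 
       (act (glUnit k s p q) a * act (glUnit k s q r) b * act (glUnit k s r p) c
        - act (glUnit k s p q) a * act (glUnit k s r p) b * act (glUnit k s q r) c
        - act (glUnit k s q r) a * act (glUnit k s p q) b * act (glUnit k s r p) c
        + act (glUnit k s q r) a * act (glUnit k s r p) b * act (glUnit k s p q) c
        + act (glUnit k s r p) a * act (glUnit k s p q) b * act (glUnit k s q r) c
        - act (glUnit k s r p) a * act (glUnit k s q r) b * act (glUnit k s p q) c)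
      = (3 : k) • (cyclicUnitSum act a b c - cyclicUnitSum act a c b) := by
    rw [cyclicUnitSum, cyclicUnitSum, ← Finset.sum_sub_distrib, Finset.smul_sum]
    refine Finset.sum_congr rfl fun s _ => ?_
    have hF := rot s fun p q r =>
      act (glUnit k s p q) a * act (glUnit k s q r) b * act (glUnit k s r p) c
    have hF' := rot s fun p q r =>
      act (glUnit k s q r) a * act (glUnit k s r p) b * act (glUnit k s p q) c
    have hG := rot s fun p q r =>
      act (glUnit k s p q) a * act (glUnit k s q r) c * act (glUnit k s r p) b
    have hG' := rot s fun p q r =>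
      act (glUnit k s q r) a * act (glUnit k s r p) c * act (glUnit k s p q) b
    have h3 : ∀ x : R, (3 : k) • x = 3 * x := fun x => by
      rw [Algebra.smul_def, map_ofNat]
    rw [h3, mul_sub]
    simp only [Finset.sum_add_distrib, Finset.sum_sub_distrib]
    simp only [mul_right_comm _ _ (act _ b)] at hG hG'
    simp only [mul_right_comm _ (act _ c) (act _ b)]
    linear_combination -2 * hF - hF' + 2 * hG + hG'
  rw [key]
  module

end MatrixUnits

/-! ### The cyclic sum of matrix units on generators -/

noncomputable section GeneratorSums

variable {k : Type*} [Field k] {A : Type*} [Ring A] [Algebra k A]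
variable {I : Type*} [Fintype I] [DecidableEq I] {e : I → A} {α : I → ℕ}

theorem blockMat_glUnit (S : Type*) [CommRing S] [Algebra k S] (s : I) (p q : Fin (α s)) :
    blockMat k α S (glUnit k s p q) = Matrix.single ⟨s, p⟩ ⟨s, q⟩ 1 := by
  ext ⟨t, i⟩ ⟨u, j⟩
  change algebraMap k S (Matrix.blockDiagonal' (glUnit k s p q) ⟨t, i⟩ ⟨u, j⟩) = _
  rw [Matrix.blockDiagonal'_apply, Matrix.single_apply]
  by_cases htu : t = u
  · subst htu
    by_cases hs : s = t
    · subst hs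
      by_cases hp : p = i <;> by_cases hq : q = j <;> simp [glUnit, hp, hq]
    · simp [glUnit, hs]
  · by_cases hs : s = t
    · subst hs; simp [htu]
    · simp [htu, hs]

theorem repLieAction_glUnit (s : I) (p q : Fin (α s)) (a : A) (i j : RepIndex α) :
    (repLieAction α e : LieGLα k α →ₗ⁅k⁆ _) (glUnit k s p q) (repX k e α a i j)
      = repX k e α a i ⟨s, p⟩ * (if ⟨s, q⟩ = j then 1 else 0)
        - (if i = ⟨s, p⟩ then 1 else 0) * repX k e α a ⟨s, q⟩ j := by
  rw [repLieAction_repX, blockMat_glUnit, Matrix.sub_apply]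
  congr 1
  · by_cases h : (⟨s, q⟩ : RepIndex α) = j
    · subst h; simp
    · rw [Matrix.mul_single_apply_of_ne _ _ _ _ _ (Ne.symm h)]; simp [h]
  · by_cases h : i = (⟨s, p⟩ : RepIndex α)
    · subst h; simp
    · rw [Matrix.single_mul_apply_of_ne _ _ _ _ _ h]; simp [h]

theorem blockId_eq_diagonal (S : Type*) [CommRing S] (s : I) :
    blockId S α s = Matrix.diagonal fun i => if i.1 = s then 1 else 0 := by
  ext i j
  simp only [blockId, Matrix.of_apply, Matrix.diagonal_apply, ite_and]

/-- The block indicator is the diagonal of X(e_s), so block sums become matrix products with X(e_s)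
inserted. -/
theorem sum_block {S : Type*} [CommRing S] (s : I) (f : RepIndex α → S) :
    ∑ p : Fin (α s), f ⟨s, p⟩ = ∑ P : RepIndex α, (if P.1 = s then 1 else 0) * f P := by
  rw [Fintype.sum_sigma, Finset.sum_eq_single s]
  · simp
  · intro t _ h; simp [h]
  · simp

theorem sum_mul_diagonal_mul {S n : Type*} [CommRing S] [Fintype n] [DecidableEq n] (χ : n → S)
    (E a c : Matrix n n S) (hE : E = Matrix.diagonal χ) (j m : n) (u v x y : S) :
    ∑ q, χ q * ((u * (if q = j then 1 else 0) - v * a q j)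
        * (x * c m q + y * (if m = q then 1 else 0)))
      = u * x * (c * E) m j + u * y * E m j - v * x * (c * E * a) m j - v * y * (E * a) m j := by
  have h1 : (c * E) m j = ∑ q, χ q * (if q = j then 1 else 0) * c m q := by
    rw [hE, Matrix.mul_diagonal]; simp [mul_comm]
  have h2 : E m j = ∑ q, χ q * (if q = j then 1 else 0) * (if m = q then 1 else 0) := by
    rw [hE, Matrix.diagonal_apply]; simp
  have h3 : (c * E * a) m j = ∑ q, χ q * a q j * c m q := by
    rw [hE, Matrix.mul_apply]
    exact Finset.sum_congr rfl fun t _ => by rw [Matrix.mul_diagonal]; ring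
  have h4 : (E * a) m j = ∑ q, χ q * a q j * (if m = q then 1 else 0) := by
    rw [hE, Matrix.diagonal_mul]; simp
  rw [h1, h2, h3, h4, Finset.mul_sum, Finset.mul_sum, Finset.mul_sum, Finset.mul_sum,
    ← Finset.sum_add_distrib, ← Finset.sum_sub_distrib, ← Finset.sum_sub_distrib]
  exact Finset.sum_congr rfl fun q _ => by ring

/-- Each index occurs in two neighbouring factors only, so R, Q and P are summed out in turn by
`sum_mul_diagonal_mul`, the remaining data entering as the scalars u, v, x, y. -/
theorem sum_three_factors {S n : Type*} [CommRing S] [Fintype n] [DecidableEq n] (χ : n → S)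
    (E a b c : Matrix n n S) (hE : E = Matrix.diagonal χ) (i j m p l o : n) :
    ∑ P, χ P * ∑ Q, χ Q * ∑ R, χ R *
        ((a i P * (if Q = j then 1 else 0) - (if i = P then 1 else 0) * a Q j)
          * (c m Q * (if R = p then 1 else 0) - (if m = Q then 1 else 0) * c R p)
          * (b o R * (if P = l then 1 else 0) - (if o = R then 1 else 0) * b P l))
      = (c * E * a) m j * (E * b) i l * E o p
        - (c * E * a) m j * E i l * (b * E) o p
        - (c * E) m j * (a * E * b) i l * E o p
        + (c * E) m j * (a * E) i l * (b * E) o p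
        - (E * a) m j * (E * b) i l * (E * c) o p
        + (E * a) m j * E i l * (b * E * c) o p
        + E m j * (a * E * b) i l * (E * c) o p
        - E m j * (a * E) i l * (b * E * c) o p := by
  have hR : ∀ P Q, ∑ R, χ R *
        ((a i P * (if Q = j then 1 else 0) - (if i = P then 1 else 0) * a Q j)
          * (c m Q * (if R = p then 1 else 0) - (if m = Q then 1 else 0) * c R p)
          * (b o R * (if P = l then 1 else 0) - (if o = R then 1 else 0) * b P l))
      = (a i P * (if Q = j then 1 else 0) - (if i = P then 1 else 0) * a Q j)
        * (((if P = l then 1 else 0) * (b * E) o p - b P l * E o p) * c m Q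
          + (b P l * (E * c) o p - (if P = l then 1 else 0) * (b * E * c) o p)
            * (if m = Q then 1 else 0)) := by
    intro P Q
    have h := sum_mul_diagonal_mul χ E c b hE p o (c m Q) (if m = Q then 1 else 0)
      (if P = l then 1 else 0) (-b P l)
    refine Eq.trans ?_ ((congrArg
      ((a i P * (if Q = j then 1 else 0) - (if i = P then 1 else 0) * a Q j) * ·) h).trans ?_)
    · simp only [Finset.mul_sum]
      exact Finset.sum_congr rfl fun R _ => by ring
    · ring
  have hQ := fun P => sum_mul_diagonal_mul χ E a c hE j m (a i P) (if i = P then 1 else 0)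
    ((if P = l then 1 else 0) * (b * E) o p - b P l * E o p)
    (b P l * (E * c) o p - (if P = l then 1 else 0) * (b * E * c) o p)
  have hP := fun u v => sum_mul_diagonal_mul χ E b a hE l i u v
  simp only [hR, hQ]
  calc _ = ∑ P, χ P * (((b * E) o p * (if P = l then 1 else 0) - E o p * b P l)
          * ((c * E) m j * a i P + (-(c * E * a) m j) * (if i = P then 1 else 0)))
        + ∑ P, χ P * (((b * E * c) o p * (if P = l then 1 else 0) - (E * c) o p * b P l)
          * ((-E m j) * a i P + (E * a) m j * (if i = P then 1 else 0))) := by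
        rw [← Finset.sum_add_distrib]
        exact Finset.sum_congr rfl fun P _ => by ring
    _ = _ := by rw [hP, hP]; ring

/-- This explains the shape of the double quasi-Poisson condition: its eight terms are the choices
of left or right multiplication in three commutators with matrix units. -/
theorem cyclicUnitSum_repX (a b c : A) (i j l m n o : RepIndex α) :
    cyclicUnitSum (repLieAction α e) (repX k e α a i j) (repX k e α c n o) (repX k e α b l m)
      = ∑ s,
        (repX k e α (c * e s * a) n j * repX k e α (e s * b) i m * repX k e α (e s) l o
        - repX k e α (c * e s * a) n j * repX k e α (e s) i m * repX k e α (b * e s) l o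
        - repX k e α (c * e s) n j * repX k e α (a * e s * b) i m * repX k e α (e s) l o
        + repX k e α (c * e s) n j * repX k e α (a * e s) i m * repX k e α (b * e s) l o
        - repX k e α (e s * a) n j * repX k e α (e s * b) i m * repX k e α (e s * c) l o
        + repX k e α (e s * a) n j * repX k e α (e s) i m * repX k e α (b * e s * c) l o
        + repX k e α (e s) n j * repX k e α (a * e s * b) i m * repX k e α (e s * c) l o
        - repX k e α (e s) n j * repX k e α (a * e s) i m * repX k e α (b * e s * c) l o) := by
  rw [cyclicUnitSum]
  refine Finset.sum_congr rfl fun s _ => ?_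
  simp only [repLieAction_glUnit, repX_mul]
  rw [← sum_three_factors (fun i : RepIndex α => if i.1 = s then 1 else 0) (repX k e α (e s))
    (repX k e α a) (repX k e α b) (repX k e α c)
    ((repX_idem e α s).trans (blockId_eq_diagonal _ s)) i j n o m l]
  simp only [← sum_block]

end GeneratorSums

/-! ### The quasi-Poisson property -/

noncomputable section QuasiPoissonProof

variable {k : Type*} [Field k] {A : Type*} [Ring A] [Algebra k A]
variable {I : Type*} [Fintype I] [DecidableEq I] {e : I → A} {α : I → ℕ}
variable {dbr : A →ₗ[k] A →ₗ[k] A ⊗[k] A}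
variable {br : RepRing k e α →ₗ[k] RepRing k e α →ₗ[k] RepRing k e α}

variable (k e) in
/-- The linear map `x ⊗ y ⊗ z ↦ x_ij y_lm z_no`. -/
def repEntry₃ (i j l m n o : RepIndex α) : (A ⊗[k] A) ⊗[k] A →ₗ[k] RepRing k e α :=
  LinearMap.mul' k (RepRing k e α) ∘ₗ
    TensorProduct.map (repEntry₂ k e α i j l m) (repEntry k e α n o)

theorem repEntry₃_tmul (i j l m n o : RepIndex α) (t : A ⊗[k] A) (z : A) :
    repEntry₃ k e i j l m n o (t ⊗ₜ z) = repEntry₂ k e α i j l m t * repX k e α z n o := rfl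

/-- Entries commute, so a rotation of tensor factors can be absorbed by rotating index pairs; the
three summands of a triple bracket are thereby matched with the three iterated brackets. -/
theorem repEntry₃_tensorRot (i j l m n o : RepIndex α) (t : (A ⊗[k] A) ⊗[k] A) :
    repEntry₃ k e i j l m n o (tensorRot k A t) = repEntry₃ k e l m n o i j t := by
  induction t using TensorProduct.induction_on with
  | zero => simp
  | add x y hx hy => rw [map_add, map_add, map_add, hx, hy]
  | tmul w z =>
    induction w using TensorProduct.induction_on with
    | zero => simp
    | add x y hx hy => rw [TensorProduct.add_tmul, map_add, map_add, map_add, hx, hy]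
    | tmul x y =>
      have : tensorRot k A ((x ⊗ₜ[k] y) ⊗ₜ[k] z) = (z ⊗ₜ[k] x) ⊗ₜ[k] y := rfl
      rw [this, repEntry₃_tmul, repEntry₃_tmul, repEntry₂_tmul, repEntry₂_tmul]
      ring

/-- By the Leibniz rule a_ij is bracketed with either factor; the flip brings the second factor to
the slot on which `rTensor` acts. -/
theorem IsInducedBracket.apply_repEntry₂ (h : IsInducedBracket e α dbr br) (a : A)
    (i j n l p o : RepIndex α) (t : A ⊗[k] A) :
    br (repX k e α a i j) (repEntry₂ k e α n l p o t)
      = repEntry₃ k e n j i l p o ((dbr a).rTensor A t)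
        + repEntry₃ k e p j i o n l ((dbr a).rTensor A (TensorProduct.comm k A A t)) := by
  induction t using TensorProduct.induction_on with
  | zero => simp
  | add x y hx hy => simp only [map_add, hx, hy]; abel
  | tmul x y =>
    rw [repEntry₂_tmul, h.biderivation.leibniz, h.on_generators, h.on_generators,
      TensorProduct.comm_tmul, LinearMap.rTensor_tmul, LinearMap.rTensor_tmul, repEntry₃_tmul,
      repEntry₃_tmul, mul_comm (repX k e α x n l)]

theorem IsInducedBracket.double_bracket (h : IsInducedBracket e α dbr br)
    (hd : IsDoubleBracket e dbr) (a b c : A) (i j p l n o : RepIndex α) :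
    br (repX k e α a i j) (br (repX k e α b p l) (repX k e α c n o))
      = repEntry₃ k e n j i l p o ((dbr a).rTensor A (dbr b c))
        - repEntry₃ k e p j i o n l ((dbr a).rTensor A (dbr c b)) := by
  rw [h.on_generators, h.apply_repEntry₂, hd.antisymm c b, map_neg, map_neg, sub_neg_eq_add]

/-- The Jacobiator on generators is given by the triple bracket. -/
theorem IsInducedBracket.jacobiator (h : IsInducedBracket e α dbr br)
    (hd : IsDoubleBracket e dbr) (a b c : A) (i j p l n o : RepIndex α) :
    br (repX k e α a i j) (br (repX k e α b p l) (repX k e α c n o))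
        + br (repX k e α b p l) (br (repX k e α c n o) (repX k e α a i j))
        + br (repX k e α c n o) (br (repX k e α a i j) (repX k e α b p l))
      = repEntry₃ k e n j i l p o (tripleBracket dbr a b c)
        - repEntry₃ k e p j i o n l (tripleBracket dbr a c b) := by
  -- Each iterated bracket gives two terms; the three positive ones form the triple bracket of (a,
  -- b, c), the three negative ones that of (a, c, b).
  simp only [tripleBracket, map_add, repEntry₃_tensorRot, h.double_bracket hd]
  ring

theorem repEntry₃_tripleBracket (h : IsDoubleQuasiPoisson e dbr) (a b c : A)
    (i j p l n o : RepIndex α) :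
    repEntry₃ k e n j i l p o (tripleBracket dbr a b c)
      = (1 / 4 : k) • cyclicUnitSum (repLieAction α e) (repX k e α a i j) (repX k e α c n o)
        (repX k e α b p l) := by
  rw [h.quasiPoisson, map_smul, cyclicUnitSum_repX, map_sum]
  simp only [map_add, map_sub, repEntry₃_tmul, repEntry₂_tmul]

/-! ### The quasi-Jacobi identity, from entries to the whole ring -/

theorem cyclicUnitSum_rotate {R : Type*} [CommRing R] [Algebra k R]
    (act : LieGLα k α →ₗ⁅k⁆ Derivation k R R) (a b c : R) :
    cyclicUnitSum act a b c = cyclicUnitSum act b c a := by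
  refine Finset.sum_congr rfl fun s _ => ?_
  refine Finset.sum_comm.trans (Finset.sum_congr rfl fun q _ => ?_)
  refine Finset.sum_comm.trans (Finset.sum_congr rfl fun r _ => Finset.sum_congr rfl fun p _ => ?_)
  ring

/-- `a ↦ cyclicUnitSum act a b c` as a derivation. -/
def cyclicUnitDerivation {R : Type*} [CommRing R] [Algebra k R]
    (act : LieGLα k α →ₗ⁅k⁆ Derivation k R R) (b c : R) : Derivation k R R :=
  ∑ s, ∑ p, ∑ q, ∑ r, (act (glUnit k s q r) b * act (glUnit k s r p) c) • act (glUnit k s p q)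

theorem cyclicUnitDerivation_apply {R : Type*} [CommRing R] [Algebra k R]
    (act : LieGLα k α →ₗ⁅k⁆ Derivation k R R) (a b c : R) :
    cyclicUnitDerivation act b c a = cyclicUnitSum act a b c := by
  simp only [cyclicUnitDerivation, cyclicUnitSum, derivation_sum_apply, Derivation.smul_apply,
    smul_eq_mul]
  refine Finset.sum_congr rfl fun s _ => Finset.sum_congr rfl fun p _ =>
    Finset.sum_congr rfl fun q _ => Finset.sum_congr rfl fun r _ => by ring

theorem IsInducedBracket.jacobiator_eq (h : IsInducedBracket e α dbr br)
    (hd : IsDoubleQuasiPoisson e dbr) (a b c : RepRing k e α) :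
    br a (br b c) + br b (br c a) + br c (br a b)
      = (1 / 4 : k) • (cyclicUnitSum (repLieAction α e) a c b
        - cyclicUnitSum (repLieAction α e) a b c) := by
  refine sub_eq_zero.mp (cyclic_eq_zero_of_generators (fun a b c =>
    br a (br b c) + br b (br c a) + br c (br a b)
      - (1 / 4 : k) • (cyclicUnitSum (repLieAction α e) a c b
        - cyclicUnitSum (repLieAction α e) a b c)) (fun x y z => ?_) (fun y z => ?_) ?_ a b c)
  · rw [cyclicUnitSum_rotate _ x y z, ← cyclicUnitSum_rotate _ y x z]
    ring
  -- By antisymmetry the Jacobiator in x is [{y, -}, {z, -}] - {{y, z}, -}; the commutator of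
  -- derivations is a derivation.
  · refine ⟨⁅h.biderivation.ad y, h.biderivation.ad z⁆ - h.biderivation.ad (br y z)
      - (1 / 4 : k) • (cyclicUnitDerivation (repLieAction α e) z y
        - cyclicUnitDerivation (repLieAction α e) y z), fun x => ?_⟩
    simp only [Derivation.sub_apply, Derivation.smul_apply, Derivation.commutator_apply,
      cyclicUnitDerivation_apply, IsAntisymmBiderivation.ad_apply]
    rw [h.biderivation.antisymm x (br y z), h.biderivation.antisymm z x,
      h.biderivation.antisymm x y, map_neg, map_neg, h.biderivation.antisymm y x]
    simp only [map_neg, neg_neg]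
    ring
  · intro a i j b p l c n o
    rw [h.jacobiator hd.toIsDoubleBracket, repEntry₃_tripleBracket hd,
      repEntry₃_tripleBracket hd, smul_sub, sub_self]

/-! ### Invariance -/

theorem repRing_smul_def (t : k) (x : RepRing k e α) :
    t • x = algebraMap k (RepRing k e α) t * x :=
  Algebra.smul_def t x

theorem repLieAction_repX_eq_sum (η : LieGLα k α) (a : A) (i j : RepIndex α) :
    (repLieAction (k := k) α e) η (repX k e α a i j)
      = ∑ p, Matrix.blockDiagonal' η p j • repX k e α a i p
        - ∑ p, Matrix.blockDiagonal' η i p • repX k e α a p j := by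
  rw [repLieAction_repX, Matrix.sub_apply, Matrix.mul_apply, Matrix.mul_apply]
  congr 1
  · refine Finset.sum_congr rfl fun p _ => ?_
    exact (mul_comm _ _).trans (repRing_smul_def _ _).symm
  · refine Finset.sum_congr rfl fun p _ => ?_
    exact (repRing_smul_def _ _).symm

/-- The four terms of η acting on d'_lj d''_im are regrouped by the pairs (i, j) and (l, m), which
cross the two factors: this is how η acts on a_ij and on b_lm. -/
theorem repLieAction_repEntry₂ (η : LieGLα k α) (i j l m : RepIndex α) (t : A ⊗[k] A) :
    (repLieAction (k := k) α e) η (repEntry₂ k e α l j i m t)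
      = (∑ p, Matrix.blockDiagonal' η p j • repEntry₂ k e α l p i m t
        - ∑ p, Matrix.blockDiagonal' η i p • repEntry₂ k e α l j p m t)
        + (∑ p, Matrix.blockDiagonal' η p m • repEntry₂ k e α l j i p t
        - ∑ p, Matrix.blockDiagonal' η l p • repEntry₂ k e α p j i m t) := by
  induction t using TensorProduct.induction_on with
  | zero => simp
  | add x y hx hy =>
    simp only [map_add, hx, hy, smul_add, Finset.sum_add_distrib]
    abel
  | tmul x y =>
    simp only [repEntry₂_tmul, Derivation.leibniz, repLieAction_repX_eq_sum, smul_eq_mul,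
      mul_sub, Finset.mul_sum, mul_smul_comm]
    simp only [mul_comm (repX k e α y _ _)]
    abel

theorem IsInducedBracket.lie_invariant (h : IsInducedBracket e α dbr br) (η : LieGLα k α)
    (a b : RepRing k e α) :
    (repLieAction (k := k) α e) η (br a b)
      = br (repLieAction (k := k) α e η a) b + br a (repLieAction (k := k) α e η b) := by
  refine sub_eq_zero.mp (biderivation_eq_zero_of_generators (fun a b =>
    repLieAction (k := k) α e η (br a b) - (br (repLieAction (k := k) α e η a) b + br a (repLieAction (k := k) α e η b)))
    (fun x y hxy => ?_) (fun x => ?_) (fun a i j b l m => ?_) a b)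
  · rw [h.biderivation.antisymm y x, h.biderivation.antisymm _ x, h.biderivation.antisymm y,
      map_neg]
    linear_combination -hxy
  · refine ⟨⁅repLieAction (k := k) α e η, h.biderivation.ad x⁆
      - h.biderivation.ad (repLieAction (k := k) α e η x), fun y => ?_⟩
    rw [Derivation.sub_apply, Derivation.commutator_apply]
    simp only [IsAntisymmBiderivation.ad_apply]
    ring
  · rw [h.on_generators, repLieAction_repEntry₂, repLieAction_repX_eq_sum,
      repLieAction_repX_eq_sum]
    simp only [map_sub, map_sum, map_smul, LinearMap.sub_apply, LinearMap.sum_apply,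
      LinearMap.smul_apply, h.on_generators, sub_self]

/-! ### Invariance of the bracket under the group -/

theorem repGroupAction_repX_eq_sum (g : GLα k α) (a : A) (i j : RepIndex α) :
    repGroupAction α e g (repX k e α a i j)
      = ∑ q, ∑ p, (Matrix.blockDiagonal' g⁻¹.toLie i p * Matrix.blockDiagonal' g.toLie q j) •
        repX k e α a p q := by
  rw [repGroupAction_repX, Matrix.mul_apply]
  refine Finset.sum_congr rfl fun q _ => ?_
  rw [Matrix.mul_apply, Finset.sum_mul]
  refine Finset.sum_congr rfl fun p _ => ?_
  refine Eq.trans ?_ (repRing_smul_def _ _).symm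
  rw [map_mul, mul_right_comm]
  rfl

theorem repGroupAction_repEntry₂ (g : GLα k α) (i j l m : RepIndex α) (t : A ⊗[k] A) :
    repGroupAction α e g (repEntry₂ k e α l j i m t)
      = ∑ q, ∑ p, (Matrix.blockDiagonal' g⁻¹.toLie i p * Matrix.blockDiagonal' g.toLie q j) •
        ∑ s, ∑ r, (Matrix.blockDiagonal' g⁻¹.toLie l r * Matrix.blockDiagonal' g.toLie s m) •
          repEntry₂ k e α r q p s t := by
  induction t using TensorProduct.induction_on with
  | zero => simp
  | add x y hx hy => simp only [map_add, hx, hy, smul_add, Finset.sum_add_distrib]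
  | tmul x y =>
    rw [repEntry₂_tmul, map_mul, repGroupAction_repX_eq_sum, repGroupAction_repX_eq_sum,
      Finset.sum_mul_sum]
    refine Finset.sum_congr rfl fun q _ => ?_
    simp only [Finset.sum_mul_sum, Finset.smul_sum, repEntry₂_tmul]
    refine (Finset.sum_congr rfl fun s _ => Finset.sum_comm).trans (Finset.sum_comm.trans ?_)
    refine Finset.sum_congr rfl fun p _ => Finset.sum_congr rfl fun s _ =>
      Finset.sum_congr rfl fun r _ => ?_
    rw [smul_mul_smul_comm, smul_smul]
    congr 1
    ring

theorem map_sum_smul₂ {M N n : Type*} [AddCommGroup M] [Module k M] [AddCommGroup N] [Module k N]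
    [Fintype n] (B : M →ₗ[k] M →ₗ[k] N) (c d : n → n → k) (x y : n → n → M) :
    B (∑ q, ∑ p, c p q • x p q) (∑ s, ∑ r, d r s • y r s)
      = ∑ q, ∑ p, c p q • ∑ s, ∑ r, d r s • B (x p q) (y r s) := by
  -- Hiding the second argument makes the first one expand first, which fixes the nesting of the
  -- sums.
  generalize hz : ∑ s, ∑ r, d r s • y r s = z
  simp only [map_sum, map_smul, LinearMap.sum_apply, LinearMap.smul_apply]
  subst hz
  simp only [map_sum, map_smul]

/-- The transported bracket g⁻¹.{g.x, g.y} is an antisymmetric biderivation with the same values on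
entries, so uniqueness identifies it with the original. -/
theorem IsInducedBracket.group_invariant (h : IsInducedBracket e α dbr br) (g : GLα k α)
    (a b : RepRing k e α) :
    repGroupAction α e g (br a b) = br (repGroupAction α e g a) (repGroupAction α e g b) := by
  have hinv : ∀ x, repGroupAction α e g (repGroupAction α e g⁻¹ x) = x := fun x => by
    rw [← AlgHom.mul_apply, ← map_mul, mul_inv_cancel, map_one]; rfl
  have hinv' : ∀ x, repGroupAction α e g⁻¹ (repGroupAction α e g x) = x := fun x => by
    rw [← AlgHom.mul_apply, ← map_mul, inv_mul_cancel, map_one]; rfl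
  let br' : RepRing k e α →ₗ[k] RepRing k e α →ₗ[k] RepRing k e α :=
    (br.compl₁₂ (repGroupAction α e g).toLinearMap (repGroupAction α e g).toLinearMap).compr₂
      (repGroupAction α e g⁻¹).toLinearMap
  have hbr' : ∀ x y, br' x y
      = repGroupAction α e g⁻¹ (br (repGroupAction α e g x) (repGroupAction α e g y)) :=
    fun _ _ => rfl
  have h' : IsInducedBracket e α dbr br' := by
    refine ⟨⟨fun x y => ?_, fun x y z => ?_⟩, fun a b i j l m => ?_⟩
    · rw [hbr', hbr', h.biderivation.antisymm, map_neg]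
    · rw [hbr', hbr', hbr', map_mul, h.biderivation.leibniz, map_add, map_mul, map_mul, hinv',
        hinv']
    · rw [hbr', ← hinv' (repEntry₂ k e α l j i m (dbr a b)), repGroupAction_repEntry₂,
        repGroupAction_repX_eq_sum, repGroupAction_repX_eq_sum]
      have hB := map_sum_smul₂ br
        (fun p q => Matrix.blockDiagonal' g⁻¹.toLie i p * Matrix.blockDiagonal' g.toLie q j)
        (fun r s => Matrix.blockDiagonal' g⁻¹.toLie l r * Matrix.blockDiagonal' g.toLie s m)
        (repX k e α a) (repX k e α b)
      simp only [h.on_generators] at hB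
      rw [hB]
  have h2 : br' a b = br a b := by rw [h.unique h']
  rw [← h2, hbr', hinv]

/-! ### Compatibility of the group and Lie algebra actions -/

theorem derivation_map_blockMat_conj (D : Derivation k (RepRing k e α) (RepRing k e α))
    (M : Matrix (RepIndex α) (RepIndex α) (RepRing k e α)) (ξ η : LieGLα k α) :
    (blockMat k α (RepRing k e α) ξ * M * blockMat k α (RepRing k e α) η).map D
      = blockMat k α (RepRing k e α) ξ * M.map D * blockMat k α (RepRing k e α) η := by
  have h0 : ∀ ξ i j, D (blockMat k α (RepRing k e α) ξ i j) = 0 := fun ξ i j =>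
    D.map_algebraMap _
  ext i j
  simp only [Matrix.map_apply, Matrix.mul_apply, map_sum,
    Derivation.leibniz, smul_eq_mul, h0, mul_zero, zero_add, add_zero]
  refine Finset.sum_congr rfl fun _ _ => mul_comm _ _

/-- The conjugate `f ∘ D ∘ g` of a derivation, where `g` is a right inverse of `f`. -/
def conjDerivation {R : Type*} [CommRing R] [Algebra k R] (f g : R →ₐ[k] R)
    (hfg : ∀ x, f (g x) = x) (D : Derivation k R R) : Derivation k R R :=
  Derivation.mk' (f.toLinearMap ∘ₗ (D : R →ₗ[k] R) ∘ₗ g.toLinearMap) fun x y => by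
    simp [hfg]

theorem conjDerivation_apply {R : Type*} [CommRing R] [Algebra k R] (f g : R →ₐ[k] R)
    (hfg : ∀ x, f (g x) = x) (D : Derivation k R R) (x : R) :
    conjDerivation f g hfg D x = f (D (g x)) := rfl

theorem conj_commutator {S : Type*} [Ring S] {G G' : S} (h : G * G' = 1) (X E : S) :
    G * (G' * X * G * E - E * (G' * X * G)) * G' = X * (G * E * G') - G * E * G' * X := by
  calc _ = (G * G') * X * (G * E * G') - (G * E * G') * X * (G * G') := by noncomm_ring
    _ = _ := by rw [h, one_mul, mul_one]

theorem repX_map_repGroupAction (g : GLα k α) (a : A) :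
    (repX k e α a).map (repGroupAction α e g) = conjX e g a := by
  ext i j
  exact repGroupAction_repX α e g a i j

theorem repX_map_repLieAction (η : LieGLα k α) (a : A) :
    (repX k e α a).map (repLieAction (k := k) α e η)
      = repX k e α a * blockMat k α _ η - blockMat k α _ η * repX k e α a := by
  ext i j
  exact repLieAction_repX α e η a i j

/-- The group and the derivations leave scalar matrices alone, so X goes to g X g⁻¹, then to g [X,
η] g⁻¹, then to g [g⁻¹ X g, η] g⁻¹, which is [X, g η g⁻¹]. -/
theorem repX_map_conj (g : GLα k α) (η : LieGLα k α) (a : A) :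
    (((repX k e α a).map (repGroupAction α e g⁻¹)).map (repLieAction (k := k) α e η)).map
        (repGroupAction α e g)
      = (repX k e α a).map (repLieAction (k := k) α e (adjointα k α g η)) := by
  have h1 : blockMat k α (RepRing k e α) g.toLie * blockMat k α _ g⁻¹.toLie = 1 := by
    rw [← map_mul, GLα.toLie_mul_inv, map_one]
  rw [repX_map_repGroupAction, conjX, derivation_map_blockMat_conj, repX_map_repLieAction,
    Matrix.map_mul, Matrix.map_mul, Matrix.map_sub _ (map_sub _), Matrix.map_mul, Matrix.map_mul,
    repX_map_repGroupAction, conjX, inv_inv, algHom_map_blockMat, algHom_map_blockMat,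
    algHom_map_blockMat, repX_map_repLieAction, adjointα_apply, map_mul, map_mul]
  exact conj_commutator h1 _ _

theorem repLieAction_adjointα (g : GLα k α) (η : LieGLα k α) (a : RepRing k e α) :
    (repLieAction (k := k) α e) (adjointα k α g η) a
      = repGroupAction α e g (repLieAction (k := k) α e η (repGroupAction α e g⁻¹ a)) := by
  have hinv : ∀ x, repGroupAction α e g (repGroupAction α e g⁻¹ x) = x := fun x => by
    rw [← AlgHom.mul_apply, ← map_mul, mul_inv_cancel, map_one]; rfl
  rw [← conjDerivation_apply _ _ hinv]
  refine DFunLike.congr_fun (repRing_derivation_ext e α fun a i j => ?_) a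
  rw [conjDerivation_apply]
  exact (congrFun (congrFun (repX_map_conj g η a) i) j).symm

end QuasiPoissonProof

theorem mainTheorem9 {k : Type*} [Field k] [CharZero k] {A : Type*} [Ring A] [Algebra k A]
    {I : Type*} [Fintype I] [DecidableEq I] (e : I → A) (he : CompleteOrthogonalIdempotents e)
    (dbr : A →ₗ[k] A →ₗ[k] A ⊗[k] A) (hdbr : IsDoubleQuasiPoisson e dbr) (α : I → ℕ) :
    ∃ br : RepRing k e α →ₗ[k] RepRing k e α →ₗ[k] RepRing k e α,
      IsInducedBracket e α dbr br ∧
      (∀ br' : RepRing k e α →ₗ[k] RepRing k e α →ₗ[k] RepRing k e α,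
        IsInducedBracket e α dbr br' → br' = br) ∧
      IsQuasiPoissonAlgebra (traceFormα k α) (adjointα k α) (repGroupAction α e)
        (repLieAction α e) br := by
  obtain ⟨br, h⟩ := exists_isInducedBracket hdbr.toIsDoubleBracket α
  exact ⟨br, h, fun br' h' => h.unique h',
    { form_symm := traceFormα_symm
      form_nondegenerate := traceFormα_nondegenerate
      form_invariant := traceFormα_invariant
      Ad_lie := adjointα_lie
      compatible := repLieAction_adjointα
      biderivation := h.biderivation
      lie_invariant := h.lie_invariant
      quasiJacobi := fun a b c => by
        rw [half_trivectorEval_cartanTrivector, h.jacobiator_eq hdbr]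
      group_invariant := h.group_invariant
      cartan_invariant := fun g => map_cartanTrivector _ traceFormα_symm _ _ (adjointα_lie g)
        (adjointα_adjointα_inv g) (traceFormα_adjointα g) }⟩
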